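/- Let $n\ge 2$, $N=2^{\lfloor (n+1)/2\rfloor}$ and $2^\sharp=\frac{2n}{n-1}$. Let $\sigma_1,\dots,\sigma_n$ be complex $\frac N2\times\frac N2$ matrices such that the Hermitian $N\times N$ matrices $$\alpha_j=\begin{pmatrix}0&\sigma_j^*\\ \sigma_j&0\end{pmatrix}\qquad\text{satisfy}\qquad \alpha_j\alpha_k+\alpha_k\alpha_j=2\delta_{jk}I_N,\quad 1\le j,k\le n$$ (for $n=2$ one may take $\sigma_1=1$, $\sigma_2=i$; for odd $n$ one may take all $\sigma_j$ Hermitian). Put $\mathcal D=-i\sum_{j=1}^n\alpha_j\partial_{x_j}$ and, for $0\ne x\in\mathbb R^n$, $$\mathcal U(x)=\begin{pmatrix}0&-i\,s(x)^*\\ i\,s(x)&0\end{pmatrix},\qquad s(x)=\sum_{j=1}^n\frac{x_j}{|x|}\sigma_j .$$ Let $H:\{z\in\mathbb C^N:|z|=1\}\to\mathbb C^{N\times N}$ be Hölder continuous of order $\min\{\frac2{n-1},1\}$ and satisfy $$H(z)=\mathcal U(\omega)\,H(\mathcal U(\omega)^*z)\,\mathcal U(\omega)^*\qquad\text{for all }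 z\in\mathbb C^N,\ \omega\in\mathbb R^n\text{ with }|z|=|\omega|=1,$$ and set $h(z)=|z|^{2^\sharp-2}H(z/|z|)$ for $z\ne0$ and $h(0)=0$. Let $\psi\in L^{2^\sharp}(\mathbb R^n,\mathbb C^N)$ be a weak solution of $\mathcal D\psi=h(\psi)\psi$, i.e. $$\int_{\mathbb R^n}\langle\mathcal D\varphi,\psi\rangle\,dx=\int_{\mathbb R^n}\langle\varphi,h(\psi)\psi\rangle\,dx\qquad\text{for all }\varphi\in C_c^\infty(\mathbb R^n,\mathbb C^N).$$ Then $\psi\in C^{1,\alpha}(\mathbb R^n,\mathbb C^N)$ for every $0<\alpha<\min\{\frac2{n-1},1\}$; that is, $\psi$ agrees almost everywhere with a continuously differentiable function which is bounded, has a bounded derivative, and whose derivative is globally Hölder continuous of order $\alpha$ on $\mathbb R^n$, for every such $\alpha$. -/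

import Mathlib

open MeasureTheory

noncomputable section

namespace CriticalDirac

/-- Euclidean space of dimension `n`. -/
abbrev Space (n : ℕ) : Type := EuclideanSpace ℝ (Fin n)

/-- Half the number of spinor components, `N / 2`, where `N = 2 ^ ⌊(n + 1) / 2⌋`. -/
def halfDim (n : ℕ) : ℕ := 2 ^ ((n + 1) / 2 - 1)

/-- For `n ≥ 1` the number of spinor components is `N = 2 ^ ⌊(n + 1) / 2⌋`. -/
theorem halfDim_add_halfDim {n : ℕ} (hn : 1 ≤ n) :
    halfDim n + halfDim n = 2 ^ ((n + 1) / 2) := by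
  obtain ⟨k, hk⟩ : ∃ k, (n + 1) / 2 = k + 1 := ⟨(n + 1) / 2 - 1, by omega⟩
  simp only [halfDim, hk, Nat.add_sub_cancel]
  ring

/-- Indices of spinor components, split into an upper and a lower half. -/
abbrev SpinorIndex (n : ℕ) : Type := Fin (halfDim n) ⊕ Fin (halfDim n)

/-- The space of spinors `ℂ ^ N`, with its Hermitian norm. -/
abbrev Spinor (n : ℕ) : Type := EuclideanSpace ℂ (SpinorIndex n)

/-- Complex `N × N` matrices. -/
abbrev SpinorMatrix (n : ℕ) : Type := Matrix (SpinorIndex n) (SpinorIndex n) ℂ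

/-- Complex `N / 2 × N / 2` matrices. -/
abbrev HalfMatrix (n : ℕ) : Type := Matrix (Fin (halfDim n)) (Fin (halfDim n)) ℂ

/-- A matrix as a (continuous) linear operator on spinors. Its norm is the operator norm. -/
abbrev act {n : ℕ} (A : SpinorMatrix n) : Spinor n →L[ℂ] Spinor n :=
  Matrix.toEuclideanCLM (n := SpinorIndex n) (𝕜 := ℂ) A

/-- The Hermitian, block-antidiagonal matrix `α_j = (0, σ_j^*; σ_j, 0)`. If `σ_j` is Hermitian
this is `(0, σ_j; σ_j, 0)`. If `n = 2`, `σ_1 = 1` and `σ_2 = i`, one gets the first two Pauli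
matrices. -/
def alpha {n : ℕ} (σ : Fin n → HalfMatrix n) (j : Fin n) : SpinorMatrix n :=
  Matrix.fromBlocks 0 (σ j).conjTranspose (σ j) 0

/-- The anticommutation relations `α_j α_k + α_k α_j = 2 δ_{jk}`. -/
def IsDiracFamily {n : ℕ} (σ : Fin n → HalfMatrix n) : Prop :=
  ∀ j k : Fin n, alpha σ j * alpha σ k + alpha σ k * alpha σ j =
    if j = k then (2 : ℂ) • (1 : SpinorMatrix n) else 0

/-- The Dirac operator `𝒟 φ = - i ∑_j α_j ∂_j φ`, for differentiable `φ`. -/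
def dirac {n : ℕ} (σ : Fin n → HalfMatrix n) (φ : Space n → Spinor n) (x : Space n) :
    Spinor n :=
  (-Complex.I) • ∑ j : Fin n, act (alpha σ j) (fderiv ℝ φ x (EuclideanSpace.single j 1))

/-- `a · σ = ∑_j a_j σ_j`. -/
def dotSigma {n : ℕ} (σ : Fin n → HalfMatrix n) (a : Space n) : HalfMatrix n :=
  ∑ j : Fin n, ((a j : ℝ) : ℂ) • σ j

/-- The matrix `𝒰(x) = (0, - i (x/|x| · σ)^*; i (x/|x| · σ), 0)`, for `x ≠ 0`. -/
def unitaryU {n : ℕ} (σ : Fin n → HalfMatrix n) (x : Space n) : SpinorMatrix n :=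
  Matrix.fromBlocks 0 ((-Complex.I) • (dotSigma σ (‖x‖⁻¹ • x)).conjTranspose)
    (Complex.I • dotSigma σ (‖x‖⁻¹ • x)) 0

/-- The critical exponent `2^♯ = 2 n / (n - 1)`. -/
def critExp (n : ℕ) : ℝ := 2 * (n : ℝ) / ((n : ℝ) - 1)

/-- The exponent `min {2 / (n - 1), 1}`. -/
def holderExp (n : ℕ) : ℝ := min (2 / ((n : ℝ) - 1)) 1

/-- The nonlinearity `h(z) = |z| ^ (2^♯ - 2) H(z / |z|)`. Only the values of `H` on the unit sphere
matter: for `n ≥ 2` the prefactor vanishes at `z = 0`. -/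
def homNonlinearity {n : ℕ} (H : Spinor n → SpinorMatrix n) (z : Spinor n) : SpinorMatrix n :=
  ((‖z‖ ^ (critExp n - 2) : ℝ) : ℂ) • H (((‖z‖⁻¹ : ℝ) : ℂ) • z)

/-- `H` is Hölder continuous of order `β` on the unit sphere of the spinor space. -/
def IsHolderOnSphere {n : ℕ} (β : ℝ) (H : Spinor n → SpinorMatrix n) : Prop :=
  ∃ C : ℝ, ∀ z w : Spinor n, ‖z‖ = 1 → ‖w‖ = 1 → ‖act (H z - H w)‖ ≤ C * ‖z - w‖ ^ β

/-- `H(z) = 𝒰(ω) H(𝒰(ω)^* z) 𝒰(ω)^*` for all unit vectors `z` and `ω`. -/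
def IsConjInvariant {n : ℕ} (σ : Fin n → HalfMatrix n) (H : Spinor n → SpinorMatrix n) : Prop :=
  ∀ (z : Spinor n) (ω : Space n), ‖z‖ = 1 → ‖ω‖ = 1 →
    H z = unitaryU σ ω * H (act (unitaryU σ ω).conjTranspose z) * (unitaryU σ ω).conjTranspose

/-- `ψ` satisfies `𝒟 ψ = h(x, ψ) ψ` in the weak sense: for all test functions `φ`,
`∫ ⟨𝒟 φ, ψ⟩ = ∫ ⟨φ, h(x, ψ) ψ⟩`. -/
def IsWeakSolution {n : ℕ} (σ : Fin n → HalfMatrix n)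
    (h : Space n → Spinor n → SpinorMatrix n) (ψ : Space n → Spinor n) : Prop :=
  ∀ φ : Space n → Spinor n, ContDiff ℝ (⊤ : ℕ∞) φ → HasCompactSupport φ →
    ∫ x, inner ℂ (dirac σ φ x) (ψ x) = ∫ x, inner ℂ (φ x) (act (h x (ψ x)) (ψ x))

/-- `φ ∈ C^{1,α}(ℝ^n, ℂ^N)`: `φ` is continuously differentiable, `φ` and its derivative are bounded,
and the derivative is (globally) Hölder continuous of order `α`. -/
def MemC1Holder {n : ℕ} (α : ℝ) (φ : Space n → Spinor n) : Prop :=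
  ContDiff ℝ 1 φ ∧ ∃ C : ℝ, (∀ x, ‖φ x‖ ≤ C) ∧ (∀ x, ‖fderiv ℝ φ x‖ ≤ C) ∧
    ∀ x y, ‖fderiv ℝ φ x - fderiv ℝ φ y‖ ≤ C * ‖x - y‖ ^ α

end CriticalDirac

end

/-!
The critical exponent makes the nonlinear term `f = h(ψ) ψ` satisfy `|f| ≤ C |ψ|^(s + 1)` with
`s = 2 / (n - 1)`, so that `|ψ|^s` lies in `L^n`. All the estimates below are uniform over `ℝ^n`,
so that boundedness and the Hölder bounds come out globally.

**Representation.** Instead of the fundamental solution of the Dirac operator, the argument uses a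
smooth mollifier `η(y) = ρ(|y|²)` supported in the unit ball. Since `η` is radial, the derivative
in `t` of the kernel `t^(-n) η((x - y) / t)` is the Dirac operator (in `y`) applied to a test
function, because the Clifford relations give `(∑ u_j α_j)² = |u|²`. Testing the equation with it
yields `∂_t (η_t * ψ) = Θ_t * f`, where `Θ(y) = -i η(y) ∑ y_j α_j` (`inv_smul_avg_timeKernel`), and
so `ψ = η_1 * ψ - ∫_0^1 Θ_t * f dt` almost everywhere. Each regularity statement is now an estimate
at a single scale `t`, integrated over `t ∈ (0, 1)`.

**Boundedness.** With `T g(x) = ∫_0^1 ∫_{|z| ≤ 1} g(x - t z) dz dt`, the representation gives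
`|ψ| ≤ C A(|ψ|) + C T(|ψ|^s |ψ|)`, where `A` integrates over balls of radius one. This is estimated
in weak Lebesgue spaces, in the form `∫_E g ≤ B |E|^a` for all `E` of finite measure (`WeakBound`,
of exponent `a`). In this form the weak
Hardy-Littlewood-Sobolev inequality for `T` is elementary: split the scales at `t = |E|^(1/n)`
(`WeakBound.potential`). The weak Hölder inequality is a layer cake formula (`WeakBound.mul`).
Splitting `|ψ|^s` at a large height `M` of `|ψ|`, the part above `M` is small in `L^n` and gives a
contraction for two exponents `a < b` at once, while the part below `M` contributes a bounded term.
Iterating the inequality moves `ψ` from the exponent `a` to `b` (`WeakBound.of_le_add`). If `b` is close to `1`,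
then `T(|ψ|^(s + 1))` is bounded (`WeakBound.potential_le`), hence so is `ψ`.

**Hölder estimates.** If `f` is bounded, `Θ_t * f` is bounded and has Lipschitz constant `O(1 / t)`,
so `ψ` is Hölder continuous of every order below one (`exists_holder_avgIntegral`). The map
`z ↦ h(z) z` is Hölder continuous of order `min {s, 1}` on bounded sets, so `f` is Hölder continuous
of every order `γ < min {s, 1}`. The kernel `∇Θ` has mean zero, whence
`∇(Θ_t * f)(x) = t⁻¹ ∫ ∇Θ(y) (f(x - t y) - f(x)) dy`. The increments of this in `x` are
`O(t^(γ - α - 1) |x - x'|^α)` for `α < γ`, which is integrable in `t` (`memC1Holder_avgIntegral`).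
-/

namespace CriticalDirac

/-! ### Weak Lebesgue bounds and the truncated potential -/

section

open Set Filter Topology ENNReal

variable {n : ℕ}

/-- `g` belongs to weak `L^q` for `1 - 1 / q = a`, with bound `B`; in what follows, this is called
the weak space of exponent `a`. The condition on integrals over sets of finite measure is used,
rather than one on the distribution function, because it is linear in `g` and invariant under
translations. -/
def WeakBound (a : ℝ) (B : ℝ≥0∞) (g : Space n → ℝ≥0∞) : Prop :=
  ∀ E, MeasurableSet E → volume E ≠ ∞ → ∫⁻ x in E, g x ≤ B * volume E ^ a

/-- The integral of `g` over the ball of radius `t` around `x`, divided by `t ^ n`, rescaled to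
the unit ball. It is not normalized by the volume of the unit ball. -/
noncomputable def ballAvg (g : Space n → ℝ≥0∞) (t : ℝ) (x : Space n) : ℝ≥0∞ :=
  ∫⁻ z in Metric.closedBall 0 1, g (x - t • z)

/-- The potential `∫₀¹ t⁻ⁿ ∫_{|x - y| ≤ t} g(y) dy dt`. It is the convolution of `g` with a kernel
supported in the unit ball which behaves like a multiple of `|x|^(1 - n)` at the origin. -/
noncomputable def potential (g : Space n → ℝ≥0∞) (x : Space n) : ℝ≥0∞ :=
  ∫⁻ t in Ioo (0 : ℝ) 1, ballAvg g t x

/-- The volume of the unit ball. -/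
noncomputable def unitVol (n : ℕ) : ℝ≥0∞ := volume (Metric.closedBall (0 : Space n) 1)

theorem unitVol_ne_top : unitVol n ≠ ∞ := measure_closedBall_lt_top.ne

theorem lintegral_Ioi_rpow {b ρ : ℝ} (hb : 1 < b) (hρ : 0 < ρ) :
    ∫⁻ t in Ioi ρ, ENNReal.ofReal (t ^ (-b)) = ENNReal.ofReal (ρ ^ (1 - b) / (b - 1)) := by
  rw [← ofReal_integral_eq_lintegral_ofReal (integrableOn_Ioi_rpow_of_lt (by linarith) hρ)
    ((ae_restrict_mem measurableSet_Ioi).mono fun t ht =>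
      Real.rpow_nonneg (hρ.le.trans (le_of_lt ht)) _),
    integral_Ioi_rpow_of_lt (by linarith) hρ]
  congr 1
  rw [show -b + 1 = -(b - 1) by ring, neg_div_neg_eq, show -(b - 1) = 1 - b by ring]

theorem lintegral_Ioo_rpow_lt_top {b : ℝ} (hb : b < 1) :
    ∫⁻ t in Ioo (0 : ℝ) 1, ENNReal.ofReal (t ^ (-b)) < ∞ := by
  have h : IntegrableOn (fun t : ℝ => t ^ (-b)) (Ioo 0 1) :=
    (intervalIntegral.integrableOn_Ioo_rpow_iff one_pos).2 (by linarith)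
  exact h.lintegral_lt_top

theorem lintegral_Ioi_le_of_two_bounds {G : ℝ → ℝ≥0∞} {c₀ c₁ : ℝ≥0∞} {b ρ : ℝ} (hb : 1 < b)
    (hρ : 0 < ρ) (h₀ : ∀ t, 0 < t → G t ≤ c₀)
    (h₁ : ∀ t, 0 < t → G t ≤ c₁ * ENNReal.ofReal (t ^ (-b))) :
    ∫⁻ t in Ioi 0, G t ≤ ENNReal.ofReal ρ * c₀ + c₁ * ENNReal.ofReal (ρ ^ (1 - b) / (b - 1)) := by
  rw [← Ioc_union_Ioi_eq_Ioi hρ.le]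
  refine (lintegral_union_le _ _ _).trans (add_le_add ?_ ?_)
  · calc ∫⁻ t in Ioc 0 ρ, G t ≤ ∫⁻ t in Ioc 0 ρ, c₀ :=
          setLIntegral_mono measurable_const fun t ht => h₀ t ht.1
      _ = ENNReal.ofReal ρ * c₀ := by simp [mul_comm]
  · rw [← lintegral_Ioi_rpow hb hρ, ← lintegral_const_mul _ (by fun_prop)]
    exact setLIntegral_mono (by fun_prop) fun t ht => h₁ t (hρ.trans ht)

theorem measurable_ballAvg_uncurry {g : Space n → ℝ≥0∞} (hg : Measurable g) :
    Measurable (fun q : Space n × ℝ => ballAvg g q.2 q.1) := by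
  unfold ballAvg
  exact Measurable.lintegral_prod_right' (f := fun q : (Space n × ℝ) × Space n =>
    g (q.1.1 - q.1.2 • q.2)) (by fun_prop)

theorem measurable_potential {g : Space n → ℝ≥0∞} (hg : Measurable g) :
    Measurable (potential g) :=
  Measurable.lintegral_prod_right' (f := fun q : Space n × ℝ => ballAvg g q.2 q.1)
    (measurable_ballAvg_uncurry hg)

theorem measurable_ballAvg {g : Space n → ℝ≥0∞} (hg : Measurable g) (t : ℝ) :
    Measurable (ballAvg g t) :=
  (measurable_ballAvg_uncurry hg).comp (measurable_id.prodMk measurable_const)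

theorem ballAvg_add {g g' : Space n → ℝ≥0∞} (hg : Measurable g) (t : ℝ) (x : Space n) :
    ballAvg (fun y => g y + g' y) t x = ballAvg g t x + ballAvg g' t x := by
  unfold ballAvg
  exact lintegral_add_left (by fun_prop) _

theorem potential_add {g g' : Space n → ℝ≥0∞} (hg : Measurable g) (x : Space n) :
    potential (fun y => g y + g' y) x = potential g x + potential g' x := by
  unfold potential
  simp_rw [ballAvg_add hg]
  exact lintegral_add_left
    ((measurable_ballAvg_uncurry hg).comp (measurable_const.prodMk measurable_id)) _

theorem ae_translate {p : Space n → Prop} (h : ∀ᵐ y, p y) (x : Space n) {t : ℝ} (ht : t ≠ 0) :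
    ∀ᵐ z, p (x - t • z) := by
  have h1 : Measure.QuasiMeasurePreserving (fun z : Space n => t • z) volume volume := by
    refine ⟨by fun_prop, ?_⟩
    rw [Measure.map_addHaar_smul _ ht]
    exact Measure.smul_absolutelyContinuous
  exact ((quasiMeasurePreserving_sub_left volume x).comp h1).ae h

theorem ballAvg_mono_ae {g g' : Space n → ℝ≥0∞} (h : ∀ᵐ y, g y ≤ g' y) {t : ℝ} (ht : t ≠ 0)
    (x : Space n) : ballAvg g t x ≤ ballAvg g' t x :=
  lintegral_mono_ae (ae_restrict_of_ae (ae_translate h x ht))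

theorem potential_mono_ae {g g' : Space n → ℝ≥0∞} (h : ∀ᵐ y, g y ≤ g' y) (x : Space n) :
    potential g x ≤ potential g' x :=
  setLIntegral_mono' measurableSet_Ioo fun _ ht => ballAvg_mono_ae h ht.1.ne' x

theorem ballAvg_eq {g : Space n → ℝ≥0∞} (hg : Measurable g) {t : ℝ} (ht : 0 < t) (x : Space n) :
    ballAvg g t x = ENNReal.ofReal (t ^ (-(n : ℝ))) * ∫⁻ y in Metric.closedBall x t, g y := by
  set G : Space n → ℝ≥0∞ := (Metric.closedBall x t).indicator g with hG
  have hGm : Measurable G := hg.indicator measurableSet_closedBall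
  have h1 : ballAvg g t x = ∫⁻ z, G (x - t • z) := by
    rw [ballAvg, ← lintegral_indicator measurableSet_closedBall]
    congr 1
    ext z
    have : z ∈ Metric.closedBall (0 : Space n) 1 ↔ x - t • z ∈ Metric.closedBall x t := by
      simp [norm_smul, abs_of_pos ht, ht]
    by_cases hz : z ∈ Metric.closedBall (0 : Space n) 1
    · rw [indicator_of_mem hz, hG, indicator_of_mem (this.1 hz)]
    · rw [indicator_of_notMem hz, hG, indicator_of_notMem (fun h => hz (this.2 h))]
  have h2 : ∫⁻ z, G (x - t • z) = ENNReal.ofReal (t ^ (-(n : ℝ))) * ∫⁻ w, G (x - w) := by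
    have := lintegral_map (μ := (volume : Measure (Space n))) (f := fun w => G (x - w))
      (g := fun z => t • z) (by fun_prop) (by fun_prop)
    rw [← this, Measure.map_addHaar_smul _ ht.ne', lintegral_smul_measure, smul_eq_mul]
    congr 2
    rw [abs_of_pos (by positivity), Real.rpow_neg ht.le]
    simp
  rw [h1, h2, lintegral_sub_left_eq_self (fun w => G w) x,
    lintegral_indicator measurableSet_closedBall]

theorem volume_closedBall_eq (x : Space n) {t : ℝ} (ht : 0 ≤ t) :
    volume (Metric.closedBall x t) = ENNReal.ofReal (t ^ (n : ℝ)) * unitVol n := by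
  rw [unitVol, Measure.addHaar_closedBall' _ _ ht]
  simp

theorem WeakBound.ballAvg_le {a : ℝ} {B : ℝ≥0∞} {g : Space n → ℝ≥0∞} (hg : Measurable g)
    (ha : 0 ≤ a) (h : WeakBound a B g) {t : ℝ} (ht : 0 < t) (x : Space n) :
    ballAvg g t x ≤ B * unitVol n ^ a * ENNReal.ofReal (t ^ (-(n * (1 - a)))) := by
  rw [ballAvg_eq hg ht]
  refine (mul_le_mul_right (h _ measurableSet_closedBall measure_closedBall_lt_top.ne) _).trans ?_
  rw [volume_closedBall_eq x ht.le, ENNReal.mul_rpow_of_nonneg _ _ ha,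
    ENNReal.ofReal_rpow_of_pos (by positivity), ← Real.rpow_mul ht.le,
    show -(n * (1 - a)) = -(n : ℝ) + n * a by ring, Real.rpow_add ht,
    ENNReal.ofReal_mul (by positivity)]
  apply le_of_eq; ring

theorem WeakBound.ballAvg {a : ℝ} {B : ℝ≥0∞} {g : Space n → ℝ≥0∞} (hg : Measurable g)
    (h : WeakBound a B g) (t : ℝ) : WeakBound a (unitVol n * B) (ballAvg g t) := by
  intro E hE hE'
  unfold CriticalDirac.ballAvg
  rw [lintegral_lintegral_swap (by fun_prop)]
  have key : ∀ z : Space n, ∫⁻ x in E, g (x - t • z) ≤ B * volume E ^ a := by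
    intro z
    have hmp := measurePreserving_sub_right (volume : Measure (Space n)) (t • z)
    have hpre : MeasurableSet ((fun x => x + t • z) ⁻¹' E) := hE.preimage (by fun_prop)
    have h1 := hmp.setLIntegral_comp_preimage hpre hg
    have h2 : (fun x => x - t • z) ⁻¹' ((fun x => x + t • z) ⁻¹' E) = E := by
      ext x; simp
    have h3 : volume ((fun x => x + t • z) ⁻¹' E) = volume E := measure_preimage_add_right _ _ _
    rw [h2] at h1
    rw [h1, ← h3]
    exact h _ hpre (by rwa [h3])
  calc _ ≤ ∫⁻ z in Metric.closedBall (0 : Space n) 1, B * volume E ^ a :=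
        lintegral_mono fun z => key z
    _ = _ := by rw [setLIntegral_const, unitVol]; ring

/-- The weak Hardy-Littlewood-Sobolev inequality: the potential raises the exponent `a` by `1 /
n`. The scales below `|E|^(1/n)` are estimated by translation invariance, those above by a
pointwise bound. -/
theorem WeakBound.potential {a : ℝ} (hn : 0 < (n : ℝ)) (ha : 0 < a) (ha' : a + 1 / n < 1) :
    ∃ C : ℝ≥0∞, C ≠ ∞ ∧ ∀ (B : ℝ≥0∞) (g : Space n → ℝ≥0∞), Measurable g → WeakBound a B g →
      WeakBound (a + 1 / n) (C * B) (potential g) := by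
  -- The pointwise bound at scale `t` decays like `t ^ (-b)`, which is integrable at infinity.
  set b : ℝ := n * (1 - a) with hbdef
  have hb : 1 < b := by
    have : 1 / (n : ℝ) < 1 - a := by linarith
    rw [div_lt_iff₀ hn] at this
    linarith
  refine ⟨unitVol n + unitVol n ^ a * ENNReal.ofReal (1 / (b - 1)),
    ENNReal.add_ne_top.2 ⟨unitVol_ne_top, ENNReal.mul_ne_top
      (ENNReal.rpow_ne_top_of_nonneg ha.le unitVol_ne_top) ENNReal.ofReal_ne_top⟩, ?_⟩
  intro B g hg h E hE hE'
  rcases eq_or_ne (volume E) 0 with h0 | h0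
  · rw [setLIntegral_measure_zero _ _ h0]; exact zero_le
  set m := (volume E).toReal with hm
  have hm0 : 0 < m := ENNReal.toReal_pos h0 hE'
  have hEm : volume E = ENNReal.ofReal m := (ENNReal.ofReal_toReal hE').symm
  unfold CriticalDirac.potential
  rw [lintegral_lintegral_swap (measurable_ballAvg_uncurry hg).aemeasurable]
  refine (lintegral_mono_set Ioo_subset_Ioi_self).trans ?_
  refine (lintegral_Ioi_le_of_two_bounds (c₀ := unitVol n * B * volume E ^ a)
    (c₁ := B * unitVol n ^ a * volume E) (ρ := m ^ (1 / n : ℝ)) hb (by positivity)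
    (fun t _ => h.ballAvg hg t E hE hE') (fun t ht => ?_)).trans ?_
  · calc _ ≤ ∫⁻ x in E, B * unitVol n ^ a * ENNReal.ofReal (t ^ (-(n * (1 - a)))) :=
          lintegral_mono fun x => h.ballAvg_le hg ha.le ht x
      _ = _ := by rw [setLIntegral_const]; ring
  · rw [hEm, ENNReal.ofReal_rpow_of_pos hm0, ENNReal.ofReal_rpow_of_pos hm0]
    have e1 : ENNReal.ofReal (m ^ (1 / n : ℝ)) * ENNReal.ofReal (m ^ a)
        = ENNReal.ofReal (m ^ (a + 1 / n)) := by
      rw [← ENNReal.ofReal_mul (by positivity), ← Real.rpow_add hm0, add_comm]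
    have e2 : ENNReal.ofReal m * ENNReal.ofReal ((m ^ (1 / n : ℝ)) ^ (1 - b) / (b - 1))
        = ENNReal.ofReal (1 / (b - 1)) * ENNReal.ofReal (m ^ (a + 1 / n)) := by
      rw [← ENNReal.ofReal_mul (by positivity),
        ← ENNReal.ofReal_mul (one_div_nonneg.2 (by linarith)), ← Real.rpow_mul hm0.le]
      congr 1
      have : m * m ^ (1 / n * (1 - b)) = m ^ (a + 1 / n) := by
        nth_rewrite 1 [← Real.rpow_one m]
        rw [← Real.rpow_add hm0]
        congr 1
        rw [hbdef]; field_simp; ring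
      rw [← this]; ring
    apply le_of_eq
    calc _ = unitVol n * B * (ENNReal.ofReal (m ^ (1 / n : ℝ)) * ENNReal.ofReal (m ^ a))
          + B * unitVol n ^ a * (ENNReal.ofReal m
            * ENNReal.ofReal ((m ^ (1 / n : ℝ)) ^ (1 - b) / (b - 1))) := by ring
      _ = _ := by rw [e1, e2]; ring

/-- The weak Hölder inequality for the product of a function `v` in weak `L^m` with a function `u`
in the weak space of exponent `a`, from the layer cake formula for `v` with respect to the measure
`u dx`. -/
theorem WeakBound.mul {a m A : ℝ} {B : ℝ≥0∞} {u : Space n → ℝ≥0∞} {v : Space n → ℝ}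
    (hm : 0 < m) (hA : 0 < A) (ha : 1 < m * a) (hu : Measurable u) (hv : Measurable v)
    (hv0 : ∀ x, 0 ≤ v x) (h : WeakBound a B u)
    (hvm : ∀ l, 0 < l → volume {x | l < v x} ≤ ENNReal.ofReal ((A / l) ^ m)) :
    WeakBound (a - 1 / m) (ENNReal.ofReal (1 + 1 / (m * a - 1)) * ENNReal.ofReal A * B)
      (fun x => ENNReal.ofReal (v x) * u x) := by
  have ha0 : 0 < a := by by_contra! h; nlinarith
  intro E hE hE'
  rcases eq_or_ne (volume E) 0 with h0 | h0
  · rw [setLIntegral_measure_zero _ _ h0]; exact zero_le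
  set μE := (volume E).toReal with hμE
  have hm0 : 0 < μE := ENNReal.toReal_pos h0 hE'
  have hEm : volume E = ENNReal.ofReal μE := (ENNReal.ofReal_toReal hE').symm
  have e0 : ∫⁻ x in E, ENNReal.ofReal (v x) * u x
      = ∫⁻ l in Ioi 0, ∫⁻ x in E ∩ {x | l < v x}, u x := by
    have h1 := lintegral_eq_lintegral_meas_lt ((volume.restrict E).withDensity u) (f := v)
      (Eventually.of_forall hv0) hv.aemeasurable
    rw [lintegral_withDensity_eq_lintegral_mul _ hu (by fun_prop)] at h1
    simp only [Pi.mul_apply, mul_comm (u _)] at h1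
    rw [h1]
    congr 1
    ext l
    rw [withDensity_apply _ (measurableSet_lt measurable_const hv),
      Measure.restrict_restrict (measurableSet_lt measurable_const hv), inter_comm]
  rw [e0]
  refine (lintegral_Ioi_le_of_two_bounds (c₀ := B * volume E ^ a)
    (c₁ := B * ENNReal.ofReal (A ^ (m * a))) (ρ := A * μE ^ (-1 / m)) ha (by positivity)
    (fun l _ => ?_) (fun l hl => ?_)).trans ?_
  · refine (h _ (hE.inter (measurableSet_lt measurable_const hv))
      (measure_ne_top_of_subset inter_subset_left hE')).trans ?_
    gcongr
    exact inter_subset_left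
  · refine (h _ (hE.inter (measurableSet_lt measurable_const hv))
      (measure_ne_top_of_subset inter_subset_left hE')).trans ?_
    rw [mul_assoc]
    gcongr
    calc volume (E ∩ {x | l < v x}) ^ a ≤ (ENNReal.ofReal ((A / l) ^ m)) ^ a := by
          gcongr
          exact (measure_mono inter_subset_right).trans (hvm l hl)
      _ = _ := by
        rw [ENNReal.ofReal_rpow_of_pos (by positivity), ← ENNReal.ofReal_mul (by positivity),
          ← Real.rpow_mul (by positivity), Real.div_rpow hA.le hl.le, Real.rpow_neg hl.le]
        rfl
  · rw [hEm, ENNReal.ofReal_rpow_of_pos hm0, ENNReal.ofReal_rpow_of_pos hm0]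
    apply le_of_eq
    have e1 : μE ^ (-1 / m) * μE ^ a = μE ^ (a - 1 / m) := by
      rw [← Real.rpow_add hm0]; congr 1; ring
    have e2 : A ^ (m * a) * (A * μE ^ (-1 / m)) ^ (1 - m * a) = A * μE ^ (a - 1 / m) := by
      rw [Real.mul_rpow hA.le (by positivity), ← Real.rpow_mul hm0.le, ← mul_assoc,
        ← Real.rpow_add hA]
      congr 1
      · simp
      · congr 1; field_simp; ring
    have hma : 0 < m * a - 1 := by linarith
    have e3 : ENNReal.ofReal (A * μE ^ (-1 / m)) * ENNReal.ofReal (μE ^ a)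
        = ENNReal.ofReal (A * μE ^ (a - 1 / m)) := by
      rw [← ENNReal.ofReal_mul (by positivity), ← e1, mul_assoc]
    have e4 : ENNReal.ofReal (A ^ (m * a))
        * ENNReal.ofReal ((A * μE ^ (-1 / m)) ^ (1 - m * a) / (m * a - 1))
        = ENNReal.ofReal (1 / (m * a - 1)) * ENNReal.ofReal (A * μE ^ (a - 1 / m)) := by
      rw [← ENNReal.ofReal_mul (by positivity), ← ENNReal.ofReal_mul (by positivity), ← e2]
      congr 1; ring
    calc _ = B * (ENNReal.ofReal (A * μE ^ (-1 / m)) * ENNReal.ofReal (μE ^ a))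
          + B * (ENNReal.ofReal (A ^ (m * a))
            * ENNReal.ofReal ((A * μE ^ (-1 / m)) ^ (1 - m * a) / (m * a - 1))) := by ring
      _ = _ := by
        rw [e3, e4, ENNReal.ofReal_add zero_le_one (by positivity), ENNReal.ofReal_one,
          ENNReal.ofReal_mul hA.le]
        ring

end

/-! ### Integrability improvement at the critical exponent -/

section

open Set Filter Topology ENNReal

variable {n : ℕ}

theorem WeakBound.mono {a : ℝ} {B B' : ℝ≥0∞} {g g' : Space n → ℝ≥0∞} (h : WeakBound a B g)
    (hB : B ≤ B') (hg : ∀ᵐ x, g' x ≤ g x) : WeakBound a B' g' := fun E hE hE' =>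
  ((lintegral_mono_ae (ae_restrict_of_ae hg)).trans (h E hE hE')).trans (by gcongr)

theorem WeakBound.add {a : ℝ} {B B' : ℝ≥0∞} {g g' : Space n → ℝ≥0∞} (hg : Measurable g)
    (h : WeakBound a B g) (h' : WeakBound a B' g') :
    WeakBound a (B + B') (fun x => g x + g' x) := by
  intro E hE hE'
  rw [lintegral_add_left hg, add_mul]
  exact add_le_add (h E hE hE') (h' E hE hE')

theorem WeakBound.const_mul {a : ℝ} {B : ℝ≥0∞} {g : Space n → ℝ≥0∞} (hg : Measurable g)
    (h : WeakBound a B g) (c : ℝ≥0∞) : WeakBound a (c * B) (fun x => c * g x) := by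
  intro E hE hE'
  rw [lintegral_const_mul _ hg, mul_assoc]
  gcongr
  exact h E hE hE'

theorem WeakBound.potential_self {a : ℝ} {B : ℝ≥0∞} {g : Space n → ℝ≥0∞} (hg : Measurable g)
    (h : WeakBound a B g) : WeakBound a (unitVol n * B) (CriticalDirac.potential g) := by
  intro E hE hE'
  unfold CriticalDirac.potential
  rw [lintegral_lintegral_swap (measurable_ballAvg_uncurry hg).aemeasurable]
  calc _ ≤ ∫⁻ t in Ioo (0 : ℝ) 1, unitVol n * B * volume E ^ a :=
        lintegral_mono fun t => h.ballAvg hg t E hE hE'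
    _ = _ := by simp

/-- A function which is bounded and lies in a weak space lies in all the weak spaces between that
one and `L^∞`. -/
theorem WeakBound.of_le_const {a b : ℝ} {B : ℝ≥0∞} {g : Space n → ℝ≥0∞} (h : WeakBound a B g)
    (hg : ∀ x, g x ≤ B) (hab : a ≤ b) (hb : b ≤ 1) : WeakBound b B g := by
  intro E hE hE'
  rcases le_total (volume E) 1 with h1 | h1
  · calc ∫⁻ x in E, g x ≤ ∫⁻ _ in E, B := lintegral_mono fun x => hg x
      _ = B * volume E ^ (1 : ℝ) := by rw [setLIntegral_const, ENNReal.rpow_one]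
      _ ≤ B * volume E ^ b := by
        gcongr B * ?_
        exact ENNReal.rpow_le_rpow_of_exponent_ge h1 hb
  · refine (h E hE hE').trans ?_
    gcongr B * ?_
    exact ENNReal.rpow_le_rpow_of_exponent_le h1 hab

/-- If `u ≤ F + S u`, where the positive linear operator `S` is a contraction for both exponents
`a` and `b`, and `u` is bounded in the weak space of exponent `a`, then `F` determines the size of
`u` in the weak space of exponent `b`. Iterating the inequality, `u` is at most a function of size
`2 B` in the second space plus a remainder which tends to zero in the first. -/
theorem WeakBound.of_le_add {a b : ℝ} (ha0 : 0 ≤ a)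
    (S : (Space n → ℝ≥0∞) → Space n → ℝ≥0∞) (hmeas : ∀ g, Measurable g → Measurable (S g))
    (hmono : ∀ g g' : Space n → ℝ≥0∞, (∀ᵐ y, g y ≤ g' y) → ∀ x, S g x ≤ S g' x)
    (hadd : ∀ g g' : Space n → ℝ≥0∞, Measurable g → ∀ x,
      S (fun y => g y + g' y) x = S g x + S g' x)
    (hSa : ∀ B g, Measurable g → WeakBound a B g → WeakBound a (2⁻¹ * B) (S g))
    (hSb : ∀ B g, Measurable g → WeakBound b B g → WeakBound b (2⁻¹ * B) (S g))
    {u F : Space n → ℝ≥0∞} {A B : ℝ≥0∞} (hu : Measurable u) (hF : Measurable F)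
    (hA : A ≠ ∞) (hua : WeakBound a A u) (hFb : WeakBound b B F)
    (hle : ∀ᵐ x, u x ≤ F x + S u x) : WeakBound b (2 * B) u := by
  have key : ∀ m : ℕ, ∃ G R : Space n → ℝ≥0∞, Measurable G ∧ Measurable R ∧
      WeakBound b (2 * B) G ∧ WeakBound a (2⁻¹ ^ m * A) R ∧ ∀ᵐ x, u x ≤ G x + R x := by
    intro m
    induction m with
    | zero =>
      refine ⟨fun _ => 0, u, measurable_const, hu, fun E _ _ => by simp, by simpa using hua, ?_⟩
      simp
    | succ m ih =>
      obtain ⟨G, R, hG, hR, hGb, hRa, hGR⟩ := ih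
      refine ⟨fun x => F x + S G x, S R, hF.add (hmeas G hG), hmeas R hR, ?_, ?_, ?_⟩
      · refine (hFb.add hF (hSb _ _ hG hGb)).mono (le_of_eq ?_) (by simp)
        rw [← mul_assoc, ENNReal.inv_mul_cancel two_ne_zero ofNat_ne_top]
        ring
      · refine (hSa _ _ hR hRa).mono (le_of_eq ?_) (by simp)
        ring
      · filter_upwards [hle] with x hx
        refine hx.trans ?_
        rw [add_assoc, ← hadd _ _ hG]
        gcongr
        exact hmono _ _ hGR x
  intro E hE hE'
  have hb : ∀ m : ℕ, ∫⁻ x in E, u x ≤ 2 * B * volume E ^ b + 2⁻¹ ^ m * (A * volume E ^ a) := by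
    intro m
    obtain ⟨G, R, hG, hR, hGb, hRa, hGR⟩ := key m
    refine (lintegral_mono_ae (ae_restrict_of_ae hGR)).trans ?_
    rw [lintegral_add_left hG, ← mul_assoc]
    exact add_le_add (hGb E hE hE') (hRa E hE hE')
  have hlim : Tendsto (fun m : ℕ => 2 * B * volume E ^ b + 2⁻¹ ^ m * (A * volume E ^ a)) atTop
      (𝓝 (2 * B * volume E ^ b + 0 * (A * volume E ^ a))) :=
    tendsto_const_nhds.add (ENNReal.Tendsto.mul_const
      (ENNReal.tendsto_pow_atTop_nhds_zero_of_lt_one (by simp))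
      (Or.inr (ENNReal.mul_ne_top hA (ENNReal.rpow_ne_top_of_nonneg ha0 hE'))))
  simpa using ge_of_tendsto' hlim hb

/-- The potential is bounded when the exponent is subcritical. -/
theorem WeakBound.potential_le {a : ℝ} {B : ℝ≥0∞} (hB : B ≠ ∞) {g : Space n → ℝ≥0∞}
    (hg : Measurable g) (ha : 0 ≤ a) (ha' : n * (1 - a) < 1) (h : WeakBound a B g) :
    ∃ C : ℝ≥0∞, C ≠ ∞ ∧ ∀ x, CriticalDirac.potential g x ≤ C := by
  refine ⟨B * unitVol n ^ a * ∫⁻ t in Ioo (0 : ℝ) 1, ENNReal.ofReal (t ^ (-(n * (1 - a)))),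
    ENNReal.mul_ne_top (ENNReal.mul_ne_top hB (ENNReal.rpow_ne_top_of_nonneg ha unitVol_ne_top))
    (lintegral_Ioo_rpow_lt_top ha').ne, fun x => ?_⟩
  rw [← lintegral_const_mul _ (by fun_prop)]
  exact setLIntegral_mono (by fun_prop) fun t ht => h.ballAvg_le hg ha ht.1 x

theorem potential_le_of_le_const {g : Space n → ℝ≥0∞} {c : ℝ≥0∞} (h : ∀ y, g y ≤ c)
    (x : Space n) : CriticalDirac.potential g x ≤ unitVol n * c := by
  calc CriticalDirac.potential g x ≤ ∫⁻ _ in Ioo (0 : ℝ) 1, unitVol n * c := by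
        refine lintegral_mono fun t => ?_
        calc ballAvg g t x ≤ ∫⁻ _ in Metric.closedBall (0 : Space n) 1, c :=
              lintegral_mono fun z => h _
          _ = _ := by rw [setLIntegral_const, unitVol, mul_comm]
    _ = _ := by simp

/-- Functions in `L^p` lie in the weak space of exponent `1 - 1 / p`. -/
theorem weakBound_of_lintegral_rpow {p : ℝ} (hp : 1 < p) {u : Space n → ℝ≥0∞} (hu : Measurable u) :
    WeakBound (1 - 1 / p) ((∫⁻ x, u x ^ p) ^ (1 / p)) u := by
  intro E hE hE'
  have hpq := Real.HolderConjugate.conjExponent hp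
  have h := ENNReal.lintegral_mul_le_Lp_mul_Lq (volume.restrict E) hpq hu.aemeasurable
    (aemeasurable_const (b := (1 : ℝ≥0∞)))
  simp only [Pi.mul_apply, mul_one, ENNReal.one_rpow, lintegral_one, Measure.restrict_apply_univ]
    at h
  rw [show 1 - 1 / p = 1 / p.conjExponent by
    have := hpq.inv_add_inv_eq_one; simp only [one_div]; linarith]
  refine h.trans ?_
  gcongr
  exact Measure.restrict_le_self

theorem exists_tail_le {u : Space n → ℝ} (hu : Measurable u) {p : ℝ}
    (hint : ∫⁻ x, ENNReal.ofReal (u x) ^ p ≠ ∞) {δ : ℝ≥0∞} (hδ : 0 < δ) :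
    ∃ M : ℝ, 0 < M ∧ ∫⁻ x in {x | M < u x}, ENNReal.ofReal (u x) ^ p ≤ δ := by
  have h : Tendsto (fun k : ℕ => ∫⁻ x, {x | (k : ℝ) < u x}.indicator
      (fun x => ENNReal.ofReal (u x) ^ p) x) atTop (𝓝 (∫⁻ _ : Space n, 0)) := by
    refine tendsto_lintegral_of_dominated_convergence _ (fun k => ?_) (fun k => ?_) hint ?_
    · exact Measurable.indicator (by fun_prop) (measurableSet_lt measurable_const hu)
    · exact Eventually.of_forall fun x => indicator_le_self _ _ _
    · refine Eventually.of_forall fun x => ?_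
      refine tendsto_const_nhds.congr' ?_
      filter_upwards [eventually_ge_atTop ⌈u x⌉₊] with k hk
      rw [indicator_of_notMem]
      simpa using Nat.ceil_le.1 hk
  rw [lintegral_zero] at h
  obtain ⟨k, hk, hk0⟩ := ((h.eventually (ge_mem_nhds hδ)).and (eventually_gt_atTop 0)).exists
  refine ⟨k, by exact_mod_cast hk0, ?_⟩
  rwa [← lintegral_indicator (measurableSet_lt measurable_const hu)]

theorem volume_lt_le_of_lintegral_rpow {v : Space n → ℝ} (hv : Measurable v)
    {m A l : ℝ} (hm : 0 < m) (hA : 0 < A) (hl : 0 < l)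
    (h : ∫⁻ x, ENNReal.ofReal (v x) ^ m ≤ ENNReal.ofReal (A ^ m)) :
    volume {x | l < v x} ≤ ENNReal.ofReal ((A / l) ^ m) := by
  have h1 := mul_meas_ge_le_lintegral₀ (μ := (volume : Measure (Space n)))
    (f := fun x => ENNReal.ofReal (v x) ^ m) (by fun_prop) (ENNReal.ofReal (l ^ m))
  have h2 : volume {x | l < v x} ≤
      volume {x | ENNReal.ofReal (l ^ m) ≤ ENNReal.ofReal (v x) ^ m} := by
    refine measure_mono fun x (hx : l < v x) => ?_
    rw [mem_ofPred_eq, ← ENNReal.ofReal_rpow_of_pos hl]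
    gcongr
  rw [Real.div_rpow hA.le hl.le, ENNReal.ofReal_div_of_pos (by positivity),
    ENNReal.le_div_iff_mul_le (Or.inl (by simpa using by positivity)) (Or.inl ofReal_ne_top),
    mul_comm]
  exact (mul_le_mul_right h2 _).trans (h1.trans h)

/-- The weak type bound on the distribution function. -/
theorem WeakBound.volume_lt_le {a B l : ℝ} {u : Space n → ℝ}
    (ha : a < 1) (hB : 0 < B) (hl : 0 < l) (hu : Measurable u)
    (h : WeakBound a (ENNReal.ofReal B) (fun x => ENNReal.ofReal (u x)))
    (hfin : volume {x | l < u x} ≠ ∞) :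
    volume {x | l < u x} ≤ ENNReal.ofReal ((B / l) ^ (1 / (1 - a))) := by
  have hE : MeasurableSet {x | l < u x} := measurableSet_lt measurable_const hu
  have h1 := h _ hE hfin
  have h2 : ENNReal.ofReal l * volume {x | l < u x} ≤
      ∫⁻ x in {x | l < u x}, ENNReal.ofReal (u x) := by
    rw [← setLIntegral_const]
    exact setLIntegral_mono (by fun_prop) fun x hx => ENNReal.ofReal_le_ofReal (le_of_lt hx)
  replace h2 := h2.trans h1
  rcases eq_or_ne (volume {x | l < u x}) 0 with h0 | h0
  · rw [h0]; exact zero_le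
  set m := (volume {x | l < u x}).toReal
  have hm0 : 0 < m := ENNReal.toReal_pos h0 hfin
  rw [show volume {x | l < u x} = ENNReal.ofReal m from (ENNReal.ofReal_toReal hfin).symm] at h2 ⊢
  rw [ENNReal.ofReal_rpow_of_pos hm0, ← ENNReal.ofReal_mul hl.le, ← ENNReal.ofReal_mul hB.le,
    ENNReal.ofReal_le_ofReal_iff (by positivity)] at h2
  apply ENNReal.ofReal_le_ofReal
  have h3 : m ^ (1 - a) ≤ B / l := by
    rw [Real.rpow_sub hm0, Real.rpow_one, div_le_div_iff₀ (by positivity) hl]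
    linarith
  calc m = (m ^ (1 - a)) ^ (1 / (1 - a)) := by
        rw [← Real.rpow_mul hm0.le, mul_one_div_cancel (by linarith), Real.rpow_one]
    _ ≤ _ := Real.rpow_le_rpow (by positivity) h3 (one_div_nonneg.2 (by linarith))

/-- If `v` is small in `L^n`, then `g ↦ K T(v g)`, with `T` the potential, halves the weak bounds
of exponent `a`. This is the scale invariant combination of the weak Hölder and
Hardy-Littlewood-Sobolev inequalities. -/
theorem exists_contraction {a : ℝ} (hn : 0 < (n : ℝ)) (ha : 1 / n < a) (ha1 : a < 1) {K : ℝ≥0∞}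
    (hK : K ≠ ∞) : ∃ ε : ℝ, 0 < ε ∧ ∀ v : Space n → ℝ, Measurable v → (∀ x, 0 ≤ v x) →
      ∫⁻ x, ENNReal.ofReal (v x) ^ (n : ℝ) ≤ ENNReal.ofReal (ε ^ (n : ℝ)) →
      ∀ (B : ℝ≥0∞) (g : Space n → ℝ≥0∞), Measurable g → WeakBound a B g →
        WeakBound a (2⁻¹ * B)
          (fun x => K * potential (fun y => ENNReal.ofReal (v y) * g y) x) := by
  obtain ⟨C, hC, hpot⟩ := WeakBound.potential (n := n) (a := a - 1 / n) hn (by linarith)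
    (by linarith)
  have hna : 1 < n * a := by
    rw [div_lt_iff₀ hn] at ha; linarith
  set c₁ : ℝ := 1 + 1 / (n * a - 1) with hc₁
  have hc₁0 : 0 < c₁ := by
    have : 0 < n * a - 1 := by linarith
    positivity
  set D : ℝ := (K * C).toReal + 1 with hD
  have hD0 : 0 < D := by positivity
  have hKC : K * C ≤ ENNReal.ofReal D := by
    rw [← ENNReal.ofReal_toReal (ENNReal.mul_ne_top hK hC)]
    exact ENNReal.ofReal_le_ofReal (by linarith)
  refine ⟨(2 * D * c₁)⁻¹, by positivity, fun v hv hv0 hint B g hg h => ?_⟩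
  have hε : 0 < (2 * D * c₁)⁻¹ := by positivity
  have h1 := h.mul hn hε hna hg hv hv0 fun l hl => volume_lt_le_of_lintegral_rpow hv hn hε hl hint
  have h2 := (hpot _ _ (by fun_prop) h1).const_mul (measurable_potential (by fun_prop)) K
  rw [sub_add_cancel] at h2
  refine h2.mono ?_ (by simp)
  rw [← hc₁]
  calc K * (C * (ENNReal.ofReal c₁ * ENNReal.ofReal (2 * D * c₁)⁻¹ * B))
      = (K * C) * ENNReal.ofReal c₁ * ENNReal.ofReal (2 * D * c₁)⁻¹ * B := by ring
    _ ≤ ENNReal.ofReal D * ENNReal.ofReal c₁ * ENNReal.ofReal (2 * D * c₁)⁻¹ * B := by gcongr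
    _ = 2⁻¹ * B := by
      rw [← ENNReal.ofReal_mul hD0.le, ← ENNReal.ofReal_mul (by positivity)]
      congr 1
      rw [show D * c₁ * (2 * D * c₁)⁻¹ = 2⁻¹ by field_simp]
      rw [ENNReal.ofReal_inv_of_pos two_pos]; simp

theorem critExp_sub_two (hn : 2 ≤ n) : critExp n - 2 = 2 / ((n : ℝ) - 1) := by
  have : (2 : ℝ) ≤ n := by exact_mod_cast hn
  have : (n : ℝ) - 1 ≠ 0 := by linarith
  rw [critExp]; field_simp; ring

/-- A function in `L^p`, with `p` the critical exponent, which is dominated by its averages at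
scale one and by the potential of its power `p - 1`, is bounded. -/
theorem exists_ae_le_of_le_potential (hn : 2 ≤ n) {u : Space n → ℝ} (hu : Measurable u)
    (hu0 : ∀ x, 0 ≤ u x) (hint : ∫⁻ x, ENNReal.ofReal (u x) ^ critExp n ≠ ∞)
    {K : ℝ≥0∞} (hK : K ≠ ∞)
    (hle : ∀ᵐ x, ENNReal.ofReal (u x) ≤ K * ballAvg (fun y => ENNReal.ofReal (u y)) 1 x
      + K * potential
        (fun y => ENNReal.ofReal (u y ^ (critExp n - 2)) * ENNReal.ofReal (u y)) x) :
    ∃ B : ℝ, ∀ᵐ x, u x ≤ B := by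
  have hn2 : (2 : ℝ) ≤ n := by exact_mod_cast hn
  have hn0 : (0 : ℝ) < n := by linarith
  have hn1 : (0 : ℝ) < (n : ℝ) - 1 := by linarith
  set s := critExp n - 2 with hs
  have hs' : s = 2 / ((n : ℝ) - 1) := critExp_sub_two hn
  have hs0 : 0 < s := by rw [hs']; positivity
  have hp : critExp n = s * n := by rw [hs', critExp]; ring
  set p := critExp n with hpdef
  have hp2 : p = s + 2 := by rw [hs]; ring
  set U : Space n → ℝ≥0∞ := fun x => ENNReal.ofReal (u x) with hU
  have hUm : Measurable U := by fun_prop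
  -- `a` encodes the given integrability; `b` makes the nonlinear term subcritical below, with
  -- `n (s + 1) (1 - b) = 1 / 2`.
  set a := 1 - 1 / p with ha
  set b := 1 - 1 / (2 * n * (s + 1)) with hb
  have hpa : 1 / p = ((n : ℝ) - 1) / (2 * n) := by rw [hpdef, critExp]; field_simp
  have ha0 : 1 / n < a := by
    rw [ha, hpa, ← sub_pos]
    have : 1 - ((n : ℝ) - 1) / (2 * n) - 1 / n = (n - 1) / (2 * n) := by field_simp; ring
    rw [this]; positivity
  have ha1 : a < 1 := by
    have : 0 < 1 / p := by rw [hpa]; positivity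
    linarith
  have hab : a ≤ b := by
    have : 1 / (2 * n * (s + 1)) ≤ 1 / p := by
      apply one_div_le_one_div_of_le (by linarith)
      rw [hp2]
      nlinarith
    linarith
  have hb1 : b < 1 := by
    have : 0 < 1 / (2 * n * (s + 1)) := by positivity
    linarith
  have hn1' : 0 < 1 / (n : ℝ) := by positivity
  set A := (∫⁻ x, U x ^ p) ^ (1 / p) with hAdef
  have hA : A ≠ ∞ := ENNReal.rpow_ne_top_of_nonneg (by rw [hpa]; positivity) hint
  have hUa : WeakBound a A U := weakBound_of_lintegral_rpow (by linarith) hUm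
  -- Above a large height `M`, the factor `u ^ s` is small in `L^n`, for both exponents at once.
  obtain ⟨ε₁, hε₁, hcon₁⟩ := exists_contraction hn0 ha0 ha1 hK
  obtain ⟨ε₂, hε₂, hcon₂⟩ := exists_contraction hn0 (ha0.trans_le hab) hb1 hK
  obtain ⟨M, hM, htail⟩ := exists_tail_le hu hint
    (δ := min (ENNReal.ofReal (ε₁ ^ (n : ℝ))) (ENNReal.ofReal (ε₂ ^ (n : ℝ)))) (by
      rw [lt_min_iff]; constructor <;> simp <;> positivity)
  have hMs : MeasurableSet {x | M < u x} := measurableSet_lt measurable_const hu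
  set v : Space n → ℝ := {x | M < u x}.indicator (fun x => u x ^ s) with hv
  have hvm : Measurable v := Measurable.indicator (by fun_prop) hMs
  have hv0 : ∀ x, 0 ≤ v x := fun x => indicator_nonneg (fun x _ => Real.rpow_nonneg (hu0 x) _) x
  have hvint : ∫⁻ x, ENNReal.ofReal (v x) ^ (n : ℝ)
      ≤ min (ENNReal.ofReal (ε₁ ^ (n : ℝ))) (ENNReal.ofReal (ε₂ ^ (n : ℝ))) := by
    refine le_trans (le_of_eq ?_) htail
    rw [← lintegral_indicator hMs]
    congr 1
    ext x
    by_cases hx : x ∈ {x | M < u x}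
    · rw [hv, indicator_of_mem hx, indicator_of_mem hx, ← ENNReal.ofReal_rpow_of_nonneg (hu0 x)
        hs0.le, ← ENNReal.rpow_mul, ← hp]
    · rw [hv, indicator_of_notMem hx, indicator_of_notMem hx]
      simp only [ENNReal.ofReal_zero]
      exact ENNReal.zero_rpow_of_pos hn0
  set w : Space n → ℝ≥0∞ := {x | M < u x}ᶜ.indicator
    (fun x => ENNReal.ofReal (u x ^ s) * U x) with hw
  have hwm : Measurable w := Measurable.indicator (by fun_prop) hMs.compl
  have hsplit : (fun y => ENNReal.ofReal (u y ^ s) * U y)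
      = fun y => w y + ENNReal.ofReal (v y) * U y := by
    ext x
    by_cases hx : x ∈ {x | M < u x}
    · simp only [hw, hv, indicator_of_mem hx, indicator_of_notMem (notMem_compl_iff.2 hx), zero_add]
    · simp only [hw, hv, indicator_of_notMem hx, indicator_of_mem (mem_compl hx)]
      simp
  have hwle : ∀ x, w x ≤ ENNReal.ofReal (M ^ s) * U x := by
    intro x
    by_cases hx : x ∈ {x | M < u x}
    · simp only [hw, indicator_of_notMem (notMem_compl_iff.2 hx)]; exact zero_le
    · simp only [hw, indicator_of_mem (mem_compl hx)]
      gcongr ENNReal.ofReal ?_ * _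
      exact Real.rpow_le_rpow (hu0 x) (not_lt.1 hx) hs0.le
  have hwle' : ∀ x, w x ≤ ENNReal.ofReal (M ^ s) * ENNReal.ofReal M := by
    intro x
    by_cases hx : x ∈ {x | M < u x}
    · simp only [hw, indicator_of_notMem (notMem_compl_iff.2 hx)]; exact zero_le
    · refine (hwle x).trans ?_
      gcongr _ * ?_
      exact ENNReal.ofReal_le_ofReal (not_lt.1 hx)
  -- The part below the height `M` makes up the inhomogeneous term `F`. It is bounded, and it lies
  -- in the weak space of exponent `a`, hence in that of exponent `b`.
  set F : Space n → ℝ≥0∞ := fun x => K * ballAvg U 1 x + K * potential w x with hF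
  have hFm : Measurable F := ((measurable_ballAvg hUm 1).const_mul K).add
    ((measurable_potential hwm).const_mul K)
  have hFa := ((hUa.ballAvg hUm 1).const_mul (measurable_ballAvg hUm 1) K).add
    ((measurable_ballAvg hUm 1).const_mul K)
    ((((hUa.const_mul hUm (ENNReal.ofReal (M ^ s))).mono le_rfl
      (Eventually.of_forall hwle)).potential_self hwm).const_mul (measurable_potential hwm) K)
  set B₁ := K * (unitVol n * A) + K * (unitVol n * (ENNReal.ofReal (M ^ s) * A)) with hB₁
  have hB₁' : B₁ ≠ ∞ := by
    have := unitVol_ne_top (n := n)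
    finiteness
  set B₂ := K * (A * unitVol n ^ a) + K * (unitVol n * (ENNReal.ofReal (M ^ s) * ENNReal.ofReal M))
    with hB₂
  have hB₂' : B₂ ≠ ∞ := by
    have := unitVol_ne_top (n := n)
    have := ENNReal.rpow_ne_top_of_nonneg (hn1'.trans ha0).le this
    finiteness
  have hFB : ∀ x, F x ≤ B₂ := by
    intro x
    have h1 := hUa.ballAvg_le hUm (hn1'.trans ha0).le one_pos x
    rw [Real.one_rpow, ENNReal.ofReal_one, mul_one] at h1
    have h2 := potential_le_of_le_const hwle' x
    simp only [hF, hB₂]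
    gcongr
  have hFb : WeakBound b (max B₁ B₂) F :=
    (hFa.mono (le_max_left B₁ B₂) (by simp [hF])).of_le_const
      (fun x => (hFB x).trans (le_max_right _ _)) hab hb1.le
  have hmax : max B₁ B₂ ≠ ∞ := by simp [hB₁', hB₂']
  have hUb : WeakBound b (2 * max B₁ B₂) U := by
    refine WeakBound.of_le_add (hn1'.trans ha0).le
      (fun g x => K * potential (fun y => ENNReal.ofReal (v y) * g y) x)
      (fun g hg => (measurable_potential (by fun_prop)).const_mul K)
      (fun g g' h x => ?_) (fun g g' hg x => ?_)
      (hcon₁ v hvm hv0 (hvint.trans (min_le_left _ _)))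
      (hcon₂ v hvm hv0 (hvint.trans (min_le_right _ _))) hUm hFm hA hUa hFb ?_
    · gcongr K * ?_
      refine potential_mono_ae ?_ x
      filter_upwards [h] with y hy
      gcongr
    · simp only [mul_add]
      rw [potential_add (by fun_prop), mul_add]
    · filter_upwards [hle] with x hx
      refine hx.trans (le_of_eq ?_)
      rw [hsplit, potential_add hwm]
      simp only [hF]
      ring
  -- `u ^ s` lies in weak `L^m` with `m = 1 / (s (1 - b))`, hence `u ^ s * u` in the weak space of
  -- exponent `b - s (1 - b)`, which is subcritical.
  set B : ℝ := (2 * max B₁ B₂).toReal + 1 with hB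
  have hB0 : 0 < B := by positivity
  have hUB : WeakBound b (ENNReal.ofReal B) U := by
    refine hUb.mono ?_ (by simp)
    rw [← ENNReal.ofReal_toReal (ENNReal.mul_ne_top ofNat_ne_top hmax)]
    exact ENNReal.ofReal_le_ofReal (by linarith)
  have h1b : 1 - b = 1 / (2 * n * (s + 1)) := by rw [hb]; ring
  have hm : 0 < 1 / (s * (1 - b)) := by
    have : 0 < 1 - b := by linarith
    positivity
  have hmb : 1 < 1 / (s * (1 - b)) * b := by
    have h1 : 0 < s * (1 - b) := mul_pos hs0 (by linarith)
    rw [one_div, ← div_eq_inv_mul, lt_div_iff₀ h1]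
    have h2 : (s + 1) * (1 - b) < 1 := by
      rw [h1b, mul_one_div, div_lt_one (by positivity)]
      nlinarith
    nlinarith
  have hNL := hUB.mul (v := fun x => u x ^ s) hm (Real.rpow_pos_of_pos hB0 s) hmb hUm (by fun_prop)
    (fun x => Real.rpow_nonneg (hu0 x) s) (fun l hl => by
      have hls : 0 < l ^ (1 / s) := by positivity
      have hset : {x | l < u x ^ s} = {x | l ^ (1 / s) < u x} := by
        ext x
        simp only [mem_ofPred_eq]
        rw [one_div, Real.rpow_inv_lt_iff_of_pos hl.le (hu0 x) hs0]
      have hp0 : 0 < p := by linarith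
      have hfin : volume {x | l ^ (1 / s) < u x} ≠ ∞ := by
        have hI : ∫⁻ x, ENNReal.ofReal (u x) ^ p
            ≤ ENNReal.ofReal ((((∫⁻ x, U x ^ p).toReal + 1) ^ (1 / p)) ^ p) := by
          rw [← Real.rpow_mul (by positivity), one_div_mul_cancel hp0.ne', Real.rpow_one]
          calc _ = ENNReal.ofReal ((∫⁻ x, U x ^ p).toReal) := (ENNReal.ofReal_toReal hint).symm
            _ ≤ _ := ENNReal.ofReal_le_ofReal (by linarith)
        exact ne_top_of_le_ne_top ofReal_ne_top
          (volume_lt_le_of_lintegral_rpow hu hp0 (by positivity) hls hI)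
      rw [hset]
      refine (hUB.volume_lt_le hb1 hB0 hls hu hfin).trans (le_of_eq ?_)
      congr 1
      have : B / l ^ (1 / s) = (B ^ s / l) ^ (1 / s) := by
        rw [Real.div_rpow (by positivity) hl.le, ← Real.rpow_mul hB0.le,
          mul_one_div_cancel hs0.ne', Real.rpow_one]
      rw [this, ← Real.rpow_mul (by positivity)]
      congr 1
      rw [one_div_mul_one_div])
  obtain ⟨C, hC, hCle⟩ := hNL.potential_le (by finiteness) (by fun_prop)
    (by
      rw [one_div_one_div]
      have h2 : (s + 1) * (1 - b) < 1 := by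
        rw [h1b, mul_one_div, div_lt_one (by positivity)]
        nlinarith
      nlinarith)
    (by
      rw [one_div_one_div]
      have : n * (1 - (b - s * (1 - b))) = n * (s + 1) * (1 - b) := by ring
      rw [this, h1b, mul_one_div, div_lt_one (by positivity)]
      nlinarith [mul_pos hn0 (add_pos hs0 one_pos)])
  have hfin : K * (A * unitVol n ^ a) + K * C ≠ ∞ := by
    have := unitVol_ne_top (n := n)
    have := ENNReal.rpow_ne_top_of_nonneg (hn1'.trans ha0).le this
    finiteness
  refine ⟨(K * (A * unitVol n ^ a) + K * C).toReal, ?_⟩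
  filter_upwards [hle] with x hx
  rw [← ENNReal.ofReal_le_iff_le_toReal hfin]
  refine hx.trans ?_
  have h1 := hUa.ballAvg_le hUm (hn1'.trans ha0).le one_pos x
  rw [Real.one_rpow, ENNReal.ofReal_one, mul_one] at h1
  gcongr
  exact hCle x

end

/-! ### Averages at scale `t` against a smooth kernel -/

section

open Set Filter Topology

variable {n : ℕ} {G V W : Type*} [NormedAddCommGroup G] [NormedSpace ℝ G]
  [NormedAddCommGroup V] [NormedSpace ℝ V] [NormedAddCommGroup W] [NormedSpace ℝ W]

/-- A smooth kernel supported in the closed unit ball. -/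
structure IsKernel (κ : Space n → G) : Prop where
  smooth : ContDiff ℝ (⊤ : ℕ∞) κ
  support : ∀ y, 1 < ‖y‖ → κ y = 0

namespace IsKernel

theorem hasCompactSupport {κ : Space n → G} (h : IsKernel κ) : HasCompactSupport κ :=
  HasCompactSupport.intro (isCompact_closedBall (0 : Space n) 1) fun y hy =>
    h.support y (by simpa using hy)

theorem exists_bound {κ : Space n → G} (h : IsKernel κ) : ∃ C : ℝ, 0 ≤ C ∧ ∀ y, ‖κ y‖ ≤ C := by
  obtain ⟨C, hC⟩ := h.hasCompactSupport.exists_bound_of_continuous h.smooth.continuous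
  exact ⟨C, (norm_nonneg _).trans (hC 0), hC⟩

theorem fderiv {κ : Space n → G} (h : IsKernel κ) : IsKernel (fderiv ℝ κ) := by
  refine ⟨h.smooth.fderiv_right (by exact_mod_cast le_top), fun y hy => ?_⟩
  have : κ =ᶠ[𝓝 y] fun _ => 0 := by
    filter_upwards [(isOpen_lt continuous_const continuous_norm).mem_nhds hy] with z hz
    exact h.support z hz
  rw [this.fderiv_eq]
  simp

theorem differentiable {κ : Space n → G} (h : IsKernel κ) : Differentiable ℝ κ :=
  h.smooth.differentiable (by simp)

end IsKernel

theorem one_lt_norm_inv_smul_sub {t : ℝ} (ht : 0 < t) {x y : Space n}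
    (h : y ∉ Metric.closedBall x t) : 1 < ‖t⁻¹ • (x - y)‖ := by
  rw [norm_smul, norm_inv, Real.norm_of_nonneg ht.le, ← div_eq_inv_mul, one_lt_div ht]
  simpa [dist_comm y x, dist_eq_norm] using h

/-- The convolution of `F` with `t⁻ⁿ κ(· / t)`, rescaled to unit scale. The kernel takes values in
operators, so that its derivatives are kernels again. -/
noncomputable def avg (κ : Space n → V →L[ℝ] W) (F : Space n → V) (t : ℝ) (x : Space n) : W :=
  ∫ y, κ y (F (x - t • y))

theorem avg_eq (κ : Space n → V →L[ℝ] W) (F : Space n → V) {t : ℝ} (ht : 0 < t) (x : Space n) :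
    avg κ F t x = ∫ y, (t ^ n)⁻¹ • κ (t⁻¹ • (x - y)) (F y) := by
  have h1 := Measure.integral_comp_smul_of_nonneg (volume : Measure (Space n))
    (fun w => κ (t⁻¹ • w) (F (x - w))) t (hR := ht.le)
  simp only [smul_smul, inv_mul_cancel₀ ht.ne', one_smul, finrank_euclideanSpace,
    Fintype.card_fin] at h1
  rw [avg, h1, integral_smul]
  congr 1
  have h2 := integral_sub_left_eq_self (fun y => κ (t⁻¹ • (x - y)) (F y)) volume x
  simpa using h2

theorem avg_congr_ae (κ : Space n → V →L[ℝ] W) {F F' : Space n → V} (h : F =ᵐ[volume] F') {t : ℝ}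
    (ht : 0 < t) (x : Space n) : avg κ F t x = avg κ F' t x := by
  rw [avg_eq κ F ht, avg_eq κ F' ht]
  refine integral_congr_ae ?_
  filter_upwards [h] with y hy
  rw [hy]

theorem enorm_avg_le {κ : Space n → V →L[ℝ] W} (hs : ∀ y, 1 < ‖y‖ → κ y = 0) {C : ℝ}
    (hb : ∀ y, ‖κ y‖ ≤ C) (F : Space n → V) (t : ℝ) (x : Space n) :
    ‖avg κ F t x‖ₑ ≤ ENNReal.ofReal C * ballAvg (fun y => ‖F y‖ₑ) t x := by
  refine (enorm_integral_le_lintegral_enorm _).trans ?_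
  rw [ballAvg, ← lintegral_const_mul' _ _ ENNReal.ofReal_ne_top,
    ← lintegral_indicator measurableSet_closedBall]
  refine lintegral_mono fun y => ?_
  by_cases hy : y ∈ Metric.closedBall (0 : Space n) 1
  · rw [indicator_of_mem hy]
    refine ((κ y).le_opENorm _).trans ?_
    gcongr
    rw [← ofReal_norm]
    exact ENNReal.ofReal_le_ofReal (hb y)
  · simp [hs y (by simpa using hy)]

theorem norm_integral_le_of_kernel {κ : Space n → V →L[ℝ] W} (hs : ∀ y, 1 < ‖y‖ → κ y = 0) {C : ℝ}
    (hb : ∀ y, ‖κ y‖ ≤ C) {q : Space n → V} {c : ℝ}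
    (hq : ∀ y, ‖y‖ ≤ 1 → ‖q y‖ ≤ c) :
    ‖∫ y, κ y (q y)‖ ≤ C * c * (unitVol n).toReal := by
  rw [← setIntegral_eq_integral_of_forall_compl_eq_zero (s := Metric.closedBall (0 : Space n) 1)]
  · refine norm_setIntegral_le_of_norm_le_const measure_closedBall_lt_top fun y hy => ?_
    have hy' : ‖y‖ ≤ 1 := by simpa using hy
    exact (κ y).le_of_opNorm_le_of_le (hb y) (hq y hy')
  · intro y hy
    simp [hs y (by simpa using hy)]

theorem integrable_kernel_apply {κ : Space n → V →L[ℝ] W} (hκ : IsKernel κ) {F : Space n → V}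
    (hF : LocallyIntegrable F) {t : ℝ} (ht : 0 < t) (x : Space n) :
    Integrable fun y => κ (t⁻¹ • (x - y)) (F y) := by
  obtain ⟨C, hC, hb⟩ := hκ.exists_bound
  have hI := (hF.integrableOn_isCompact (isCompact_closedBall x t)).norm.const_mul C
  rw [← integrableOn_iff_integrable_of_support_subset (s := Metric.closedBall x t)]
  · refine hI.mono' ?_ (Eventually.of_forall fun y => (κ _).le_of_opNorm_le (hb _) _)
    have h1 : Continuous fun y => κ (t⁻¹ • (x - y)) := hκ.smooth.continuous.comp (by fun_prop)
    exact (ContinuousLinearMap.id ℝ (V →L[ℝ] W)).aestronglyMeasurable_comp₂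
      h1.aestronglyMeasurable hF.aestronglyMeasurable.restrict
  · intro y hy
    by_contra h
    apply hy
    have := one_lt_norm_inv_smul_sub ht h
    simp [hκ.support _ this]

/-- The kernel of `t ∂_t` of the averages with kernel `κ`. -/
noncomputable def timeKernel (κ : Space n → V →L[ℝ] W) (y : Space n) : V →L[ℝ] W :=
  -((n : ℝ) • κ y + fderiv ℝ κ y y)

theorem IsKernel.timeKernel {κ : Space n → V →L[ℝ] W} (h : IsKernel κ) :
    IsKernel (timeKernel κ) := by
  refine ⟨?_, fun y hy => ?_⟩
  · unfold CriticalDirac.timeKernel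
    exact ((h.smooth.const_smul _).add (h.fderiv.smooth.clm_apply contDiff_id)).neg
  · simp [CriticalDirac.timeKernel, h.support y hy, h.fderiv.support y hy]

theorem hasDerivAt_kernel_scale {κ : Space n → V →L[ℝ] W} (h : IsKernel κ) (z : Space n) {t : ℝ}
    (ht : 0 < t) : HasDerivAt (fun t : ℝ => (t ^ n)⁻¹ • κ (t⁻¹ • z))
      (t⁻¹ • (t ^ n)⁻¹ • timeKernel κ (t⁻¹ • z)) t := by
  have h1 : HasDerivAt (fun t : ℝ => (t ^ n)⁻¹) (-(n : ℝ) * (t⁻¹ * (t ^ n)⁻¹)) t := by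
    have := hasDerivAt_zpow (-(n : ℤ)) t (Or.inl ht.ne')
    rw [zpow_sub_one₀ ht.ne', zpow_neg, zpow_natCast] at this
    simp only [zpow_neg, zpow_natCast] at this
    have e : -(n : ℝ) * (t⁻¹ * (t ^ n)⁻¹) = ((-(n : ℤ) : ℤ) : ℝ) * ((t ^ n)⁻¹ * t⁻¹) := by
      push_cast; ring
    rw [e]
    exact this
  have h2 : HasDerivAt (fun t : ℝ => t⁻¹ • z) (-(t ^ 2)⁻¹ • z) t :=
    (hasDerivAt_inv ht.ne').smul_const z
  have h3 := (h.differentiable (t⁻¹ • z)).hasFDerivAt.comp_hasDerivAt t h2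
  have h4 := h1.smul h3
  convert! h4 using 1
  have : -(t ^ 2)⁻¹ • z = -t⁻¹ • (t⁻¹ • z) := by
    rw [smul_smul]; congr 1; field_simp
  rw [this, map_smul]
  simp only [timeKernel, smul_neg, smul_add, smul_smul, neg_smul, Function.comp_apply]
  rw [neg_add, add_comm]
  congr 2
  · congr 1; ring
  · rw [neg_mul, neg_smul]; congr 2; ring

theorem hasDerivAt_avg [CompleteSpace W] {κ : Space n → V →L[ℝ] W} (hκ : IsKernel κ)
    {F : Space n → V} (hF : LocallyIntegrable F) {t : ℝ} (ht : 0 < t) (x : Space n) :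
    HasDerivAt (fun t => avg κ F t x) (t⁻¹ • avg (timeKernel κ) F t x) t := by
  obtain ⟨C, hC, hb⟩ := hκ.timeKernel.exists_bound
  have hmeas : ∀ t : ℝ, AEStronglyMeasurable (fun y => (t ^ n)⁻¹ • κ (t⁻¹ • (x - y)) (F y)) := by
    intro t
    have h1 : Continuous fun y => κ (t⁻¹ • (x - y)) := hκ.smooth.continuous.comp (by fun_prop)
    exact ((ContinuousLinearMap.id ℝ (V →L[ℝ] W)).aestronglyMeasurable_comp₂
      h1.aestronglyMeasurable hF.aestronglyMeasurable).const_smul _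
  have key := hasDerivAt_integral_of_dominated_loc_of_deriv_le
    (μ := (volume : Measure (Space n))) (x₀ := t) (s := Ioo (t / 2) (2 * t))
    (F := fun (t : ℝ) y => (t ^ n)⁻¹ • κ (t⁻¹ • (x - y)) (F y))
    (F' := fun (t : ℝ) y => t⁻¹ • (t ^ n)⁻¹ • timeKernel κ (t⁻¹ • (x - y)) (F y))
    (bound := (Metric.closedBall x (2 * t)).indicator
      (fun y => (t / 2)⁻¹ * ((t / 2) ^ n)⁻¹ * (C * ‖F y‖)))
    (Ioo_mem_nhds (by linarith) (by linarith)) (Eventually.of_forall hmeas)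
    ((integrable_kernel_apply hκ hF ht x).smul _)
    (((integrable_kernel_apply hκ.timeKernel hF ht x).smul (t ^ n)⁻¹).smul t⁻¹).aestronglyMeasurable
    (Eventually.of_forall fun y r hr => ?_) ?_ (Eventually.of_forall fun y r hr => ?_)
  · have e : (fun t => avg κ F t x) =ᶠ[𝓝 t] fun t => ∫ y, (t ^ n)⁻¹ • κ (t⁻¹ • (x - y)) (F y) := by
      filter_upwards [lt_mem_nhds ht] with r hr using avg_eq κ F hr x
    rw [avg_eq _ F ht, ← integral_smul]
    exact key.2.congr_of_eventuallyEq e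
  · have hr0 : 0 < r := by have := hr.1; linarith
    by_cases hy : y ∈ Metric.closedBall x (2 * t)
    · rw [indicator_of_mem hy, norm_smul, norm_smul, norm_inv, norm_inv, norm_pow,
        Real.norm_of_nonneg hr0.le, ← mul_assoc]
      have := hr.1
      gcongr
      exact (timeKernel κ _).le_of_opNorm_le (hb _) _
    · rw [indicator_of_notMem hy]
      have := one_lt_norm_inv_smul_sub hr0 fun h =>
        hy (Metric.closedBall_subset_closedBall hr.2.le h)
      simp [hκ.timeKernel.support _ this]
  · rw [integrable_indicator_iff measurableSet_closedBall]
    exact ((hF.integrableOn_isCompact (isCompact_closedBall x _)).norm.const_mul C).const_mul _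
  · have hr0 : 0 < r := by have := hr.1; linarith
    have := (hasDerivAt_kernel_scale hκ (x - y) hr0).clm_apply (hasDerivAt_const r (F y))
    simpa using this

theorem continuousOn_avg [CompleteSpace W] {κ : Space n → V →L[ℝ] W} (hκ : IsKernel κ)
    {F : Space n → V} (hF : LocallyIntegrable F) (x : Space n) :
    ContinuousOn (fun t => avg κ F t x) (Ioi 0) := fun _ ht =>
  (hasDerivAt_avg hκ hF ht x).continuousAt.continuousWithinAt

/-- The kernel of `t ∇_x` of the averages with kernel `κ`. -/
noncomputable def gradKernel (κ : Space n → V →L[ℝ] W) (y : Space n) : V →L[ℝ] Space n →L[ℝ] W :=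
  (fderiv ℝ κ y).flip

theorem IsKernel.gradKernel {κ : Space n → V →L[ℝ] W} (h : IsKernel κ) :
    IsKernel (gradKernel κ) := by
  refine ⟨?_, fun y hy => ?_⟩
  · exact (LinearIsometryEquiv.contDiff (E := Space n →L[ℝ] V →L[ℝ] W)
      (F := V →L[ℝ] Space n →L[ℝ] W) (ContinuousLinearMap.flipₗᵢ ℝ (Space n) V W)).comp
      h.fderiv.smooth
  · rw [CriticalDirac.gradKernel, h.fderiv.support y hy]
    rfl

theorem hasFDerivAt_avg [CompleteSpace W] {κ : Space n → V →L[ℝ] W} (hκ : IsKernel κ)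
    {F : Space n → V} (hF : LocallyIntegrable F) {t : ℝ} (ht : 0 < t) (x : Space n) :
    HasFDerivAt (fun x => avg κ F t x) (t⁻¹ • avg (gradKernel κ) F t x) x := by
  obtain ⟨C, hC, hb⟩ := hκ.gradKernel.exists_bound
  have hmeas : ∀ x, AEStronglyMeasurable (fun y => (t ^ n)⁻¹ • κ (t⁻¹ • (x - y)) (F y)) := fun x =>
    ((integrable_kernel_apply hκ hF ht x).smul _).aestronglyMeasurable
  have key := hasFDerivAt_integral_of_dominated_of_fderiv_le
    (μ := (volume : Measure (Space n))) (x₀ := x) (s := Metric.ball x t) (𝕜 := ℝ)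
    (F := fun x y => (t ^ n)⁻¹ • κ (t⁻¹ • (x - y)) (F y))
    (F' := fun x y => t⁻¹ • (t ^ n)⁻¹ • gradKernel κ (t⁻¹ • (x - y)) (F y))
    (bound := (Metric.closedBall x (2 * t)).indicator
      (fun y => t⁻¹ * (t ^ n)⁻¹ * (C * ‖F y‖)))
    (Metric.ball_mem_nhds x ht) (Eventually.of_forall hmeas)
    ((integrable_kernel_apply hκ hF ht x).smul _)
    (((integrable_kernel_apply hκ.gradKernel hF ht x).smul (t ^ n)⁻¹).smul t⁻¹).aestronglyMeasurable
    (Eventually.of_forall fun y r hr => ?_) ?_ (Eventually.of_forall fun y r hr => ?_)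
  · have e : (fun x => avg κ F t x) = fun x => ∫ y, (t ^ n)⁻¹ • κ (t⁻¹ • (x - y)) (F y) :=
      funext fun x => avg_eq κ F ht x
    rw [avg_eq _ F ht, ← integral_smul, e]
    exact key
  · by_cases hy : y ∈ Metric.closedBall x (2 * t)
    · rw [indicator_of_mem hy, norm_smul, norm_smul, norm_inv, norm_inv, norm_pow,
        Real.norm_of_nonneg ht.le, ← mul_assoc]
      gcongr
      exact (gradKernel κ _).le_of_opNorm_le (hb _) _
    · rw [indicator_of_notMem hy]
      have := one_lt_norm_inv_smul_sub ht (x := r) (y := y) fun h => hy (by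
        have h1 : dist r x < t := hr
        have h2 := dist_triangle y r x
        rw [Metric.mem_closedBall] at h ⊢
        linarith)
      simp [hκ.gradKernel.support _ this]
  · rw [integrable_indicator_iff measurableSet_closedBall]
    exact ((hF.integrableOn_isCompact (isCompact_closedBall x _)).norm.const_mul C).const_mul _
  · have h1 : HasFDerivAt (fun x => t⁻¹ • (x - y)) (t⁻¹ • ContinuousLinearMap.id ℝ (Space n)) r :=
      ((hasFDerivAt_id r).sub_const y).const_smul t⁻¹
    have h2 := (hκ.differentiable (t⁻¹ • (r - y))).hasFDerivAt.comp r h1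
    have h3 := (h2.clm_apply (hasFDerivAt_const (F y) r)).const_smul (t ^ n)⁻¹
    convert! h3 using 1
    ext v
    simp [gradKernel]
    rw [smul_comm]

/-- A gradient has mean zero: averages of constant functions do not depend on the point. -/
theorem integral_gradKernel [CompleteSpace W] {κ : Space n → V →L[ℝ] W} (hκ : IsKernel κ) (v : V) :
    ∫ y, gradKernel κ y v = 0 := by
  have h1 := hasFDerivAt_avg hκ (locallyIntegrable_const v) one_pos 0
  have h2 : HasFDerivAt (fun x => avg κ (fun _ => v) 1 x) (0 : Space n →L[ℝ] W) 0 := by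
    unfold avg
    exact hasFDerivAt_const _ _
  simpa [avg] using h1.unique h2

/-- The averages converge almost everywhere as `t → 0`, by Lebesgue differentiation. -/
theorem tendsto_avg_of_integral_eq_one [CompleteSpace V] {η : Space n → ℝ} (hη : IsKernel η)
    (h1 : ∫ y, η y = 1) {F : Space n → V} (hF : LocallyIntegrable F) :
    ∀ᵐ x, Tendsto (fun t => avg (fun y => η y • ContinuousLinearMap.id ℝ V) F t x) (𝓝[>] 0)
      (𝓝 (F x)) := by
  obtain ⟨C, hC, hb⟩ := hη.exists_bound
  have hω : 0 < (unitVol n).toReal :=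
    ENNReal.toReal_pos (Metric.measure_closedBall_pos _ _ one_pos).ne' unitVol_ne_top
  filter_upwards [(Besicovitch.vitaliFamily
    (volume : Measure (Space n))).ae_tendsto_average_norm_sub hF] with x hx
  have h2 := hx.comp (Besicovitch.tendsto_filterAt volume x)
  have h3 := tendsto_integral_smul_of_tendsto_average_norm_sub (f := F) (c := F x)
    (g := fun (t : ℝ) y => (t ^ n)⁻¹ * η (t⁻¹ • (x - y))) (C * (unitVol n).toReal) h2
    (Eventually.of_forall fun t => hF.integrableOn_isCompact (isCompact_closedBall _ _)) ?_ ?_ ?_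
  · refine h3.congr' ?_
    filter_upwards [self_mem_nhdsWithin] with t ht
    rw [avg_eq _ F ht]
    simp [smul_smul]
  · refine tendsto_const_nhds.congr' ?_
    filter_upwards [self_mem_nhdsWithin] with t ht
    have := avg_eq (fun y => η y • ContinuousLinearMap.id ℝ ℝ) (fun _ => 1) ht x
    simp only [avg, smul_apply, ContinuousLinearMap.id_apply, smul_eq_mul,
      mul_one, h1] at this
    exact this
  · filter_upwards [self_mem_nhdsWithin] with t (ht : 0 < t) y hy
    by_contra h
    apply hy
    have := one_lt_norm_inv_smul_sub ht h
    simp [hη.support _ this]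
  · filter_upwards [self_mem_nhdsWithin] with t (ht : 0 < t) y
    have e : volume.real (Metric.closedBall x t) = t ^ n * (unitVol n).toReal := by
      rw [Measure.real, volume_closedBall_eq x ht.le, ENNReal.toReal_mul,
        ENNReal.toReal_ofReal (by positivity), Real.rpow_natCast]
    rw [e, mul_div_mul_right _ _ hω.ne', abs_mul, abs_of_pos (by positivity), ← div_eq_inv_mul]
    gcongr
    exact hb _

end

/-! ### The Clifford action and the mollified Dirac equation -/

section

open Set Filter Topology

variable {n : ℕ}

/-- The Clifford action `∑_j u_j α_j` of a vector `u` on spinors. -/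
noncomputable def clifford (σ : Fin n → HalfMatrix n) : Space n →L[ℝ] Spinor n →L[ℝ] Spinor n :=
  ∑ j, (EuclideanSpace.proj j : Space n →L[ℝ] ℝ).smulRight ((act (alpha σ j)).restrictScalars ℝ)

theorem clifford_apply (σ : Fin n → HalfMatrix n) (u : Space n) (v : Spinor n) :
    clifford σ u v = ∑ j, u j • act (alpha σ j) v := by
  simp [clifford]

theorem clifford_single (σ : Fin n → HalfMatrix n) (k : Fin n) (v : Spinor n) :
    clifford σ (EuclideanSpace.single k 1) v = act (alpha σ k) v := by
  rw [clifford_apply, Finset.sum_eq_single k] <;> simp +contextual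

theorem act_alpha_anticomm {σ : Fin n → HalfMatrix n} (hσ : IsDiracFamily σ) (j k : Fin n)
    (v : Spinor n) : act (alpha σ j) (act (alpha σ k) v) + act (alpha σ k) (act (alpha σ j) v)
      = if j = k then (2 : ℂ) • v else 0 := by
  have h := congrArg (fun M => act M v) (hσ j k)
  simp only [act, map_add, map_mul] at h
  split_ifs at h ⊢ <;> simpa using h

theorem act_alpha_sq {σ : Fin n → HalfMatrix n} (hσ : IsDiracFamily σ) (j : Fin n)
    (v : Spinor n) : act (alpha σ j) (act (alpha σ j) v) = v := by
  have h := act_alpha_anticomm hσ j j v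
  rw [if_pos rfl, ← two_smul ℂ] at h
  exact smul_right_injective _ two_ne_zero h

theorem clifford_clifford {σ : Fin n → HalfMatrix n} (hσ : IsDiracFamily σ) (u : Space n)
    (v : Spinor n) : clifford σ u (clifford σ u v) = ‖u‖ ^ 2 • v := by
  have h1 : clifford σ u (clifford σ u v)
      = ∑ j, ∑ k, (u j * u k) • act (alpha σ j) (act (alpha σ k) v) := by
    rw [clifford_apply σ u (clifford σ u v)]
    refine Finset.sum_congr rfl fun j _ => ?_
    rw [clifford_apply σ u v, map_sum, Finset.smul_sum]
    refine Finset.sum_congr rfl fun k _ => ?_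
    rw [mul_smul, ← Complex.coe_smul (u k), map_smul, Complex.coe_smul]
  have h2 : (2 : ℝ) • clifford σ u (clifford σ u v) = (2 : ℝ) • ‖u‖ ^ 2 • v := by
    have h3 : clifford σ u (clifford σ u v)
        = ∑ j, ∑ k, (u j * u k) • act (alpha σ k) (act (alpha σ j) v) := by
      rw [h1, Finset.sum_comm]
      simp_rw [mul_comm]
    rw [two_smul]
    nth_rewrite 1 [h1]
    rw [h3, ← Finset.sum_add_distrib]
    simp_rw [← Finset.sum_add_distrib, ← smul_add, act_alpha_anticomm hσ]
    simp only [smul_ite, smul_zero, Finset.sum_ite_eq, Finset.mem_univ, if_true]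
    rw [← Finset.sum_smul, EuclideanSpace.norm_sq_eq, smul_comm (2 : ℝ)]
    congr 1
    · exact Finset.sum_congr rfl fun j _ => by rw [Real.norm_eq_abs, sq_abs, sq]
  exact smul_right_injective _ two_ne_zero h2

theorem inner_act_alpha (σ : Fin n → HalfMatrix n) (j : Fin n) (v w : Spinor n) :
    inner ℂ (act (alpha σ j) v) w = inner ℂ v (act (alpha σ j) w) := by
  have h : (alpha σ j).conjTranspose = alpha σ j := by
    simp [alpha, Matrix.fromBlocks_conjTranspose]
  have h2 : ContinuousLinearMap.adjoint (act (alpha σ j)) = act (alpha σ j) := by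
    rw [← ContinuousLinearMap.star_eq_adjoint, act, ← map_star, Matrix.star_eq_conjTranspose, h]
  nth_rewrite 2 [← h2]
  rw [ContinuousLinearMap.adjoint_inner_right]

theorem inner_real_smul_left (r : ℝ) (v w : Spinor n) :
    inner ℂ (r • v) w = inner ℂ v (r • w) := by
  rw [← Complex.coe_smul, ← Complex.coe_smul, inner_smul_left, inner_smul_right,
    Complex.conj_ofReal]

theorem inner_clifford (σ : Fin n → HalfMatrix n) (u : Space n) (v w : Spinor n) :
    inner ℂ (clifford σ u v) w = inner ℂ v (clifford σ u w) := by
  simp_rw [clifford_apply, sum_inner, inner_sum]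
  refine Finset.sum_congr rfl fun j _ => ?_
  rw [inner_real_smul_left, inner_act_alpha, ← Complex.coe_smul, ← Complex.coe_smul, map_smul]

/-- A smooth profile `ρ` such that `y ↦ ρ(|y|²)` is a mollifier supported in the unit ball. The
values `ρ(r)` with `r < 0` are irrelevant. -/
structure IsProfile (n : ℕ) (ρ : ℝ → ℝ) : Prop where
  smooth : ContDiff ℝ (⊤ : ℕ∞) ρ
  support : ∀ r, 1 < r → ρ r = 0
  integral : ∫ y : Space n, ρ (‖y‖ ^ 2) = 1

theorem exists_isProfile (n : ℕ) : ∃ ρ, IsProfile n ρ := by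
  set g : Space n → ℝ := fun y => expNegInvGlue (1 - ‖y‖ ^ 2) with hg
  have hgc : Continuous g := (expNegInvGlue.contDiff (n := 0)).continuous.comp (by fun_prop)
  have hgs : HasCompactSupport g := by
    refine HasCompactSupport.intro (isCompact_closedBall (0 : Space n) 1) fun y hy => ?_
    have hy : 1 < ‖y‖ := by simpa using hy
    exact expNegInvGlue.zero_of_nonpos (by nlinarith)
  have hpos : 0 < ∫ y, g y :=
    hgc.integral_pos_of_hasCompactSupport_nonneg_nonzero hgs (fun y => expNegInvGlue.nonneg _)
      (x := 0) (by simp [hg, (expNegInvGlue.pos_of_pos one_pos).ne'])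
  refine ⟨fun r => (∫ y, g y)⁻¹ * expNegInvGlue (1 - r), ?_, ?_, ?_⟩
  · exact contDiff_const.mul (expNegInvGlue.contDiff.comp (contDiff_const.sub contDiff_id))
  · intro r hr
    rw [expNegInvGlue.zero_of_nonpos (by linarith), mul_zero]
  · rw [integral_const_mul]
    exact inv_mul_cancel₀ hpos.ne'

theorem IsProfile.isKernel {ρ : ℝ → ℝ} (h : IsProfile n ρ) :
    IsKernel (fun y : Space n => ρ (‖y‖ ^ 2)) :=
  ⟨h.smooth.comp (contDiff_norm_sq ℝ), fun y hy => h.support _ (by nlinarith)⟩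

theorem IsProfile.hasFDerivAt {ρ : ℝ → ℝ} (h : IsProfile n ρ) (u : Space n) :
    HasFDerivAt (fun y : Space n => ρ (‖y‖ ^ 2))
      ((2 * deriv ρ (‖u‖ ^ 2)) • (innerSL ℝ u : Space n →L[ℝ] ℝ)) u := by
  have h1 : HasDerivAt ρ (deriv ρ (‖u‖ ^ 2)) (‖u‖ ^ 2) :=
    (h.smooth.differentiable (by simp) _).hasDerivAt
  have h2 := h1.comp_hasFDerivAt u (hasStrictFDerivAt_norm_sq u).hasFDerivAt
  convert! h2 using 1
  ext v; simp; ring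

/-- The radial mollifier with profile `ρ`, as an operator valued kernel. -/
noncomputable def mollifier (n : ℕ) (ρ : ℝ → ℝ) (y : Space n) : Spinor n →L[ℝ] Spinor n :=
  ρ (‖y‖ ^ 2) • ContinuousLinearMap.id ℝ (Spinor n)

theorem IsProfile.isKernel_mollifier {ρ : ℝ → ℝ} (h : IsProfile n ρ) :
    IsKernel (mollifier n ρ) :=
  ⟨h.isKernel.smooth.smul contDiff_const, fun y hy => by
    rw [mollifier, h.isKernel.support y hy]; exact ContinuousLinearMap.ext fun v => zero_smul ℝ _⟩

/-- The kernel `-i η(y) ∑_j y_j α_j`, where `η(y) = ρ(|y|²)`. Its averages at scale `t` applied to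
`𝒟 ψ` are the derivative in `t` of the averages of `ψ` with kernel `η`. -/
noncomputable def diracKernel (σ : Fin n → HalfMatrix n) (ρ : ℝ → ℝ) (y : Space n) :
    Spinor n →L[ℝ] Spinor n :=
  ρ (‖y‖ ^ 2) • (-Complex.I) • clifford σ y

theorem IsProfile.isKernel_diracKernel {ρ : ℝ → ℝ} (h : IsProfile n ρ)
    (σ : Fin n → HalfMatrix n) : IsKernel (diracKernel σ ρ) := by
  refine ⟨h.isKernel.smooth.smul ?_, fun y hy => by
    rw [diracKernel, h.isKernel.support y hy]; exact ContinuousLinearMap.ext fun v => zero_smul ℝ _⟩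
  exact ((-Complex.I) • clifford σ).contDiff

theorem timeKernel_mollifier {ρ : ℝ → ℝ} (h : IsProfile n ρ) (u : Space n) (v : Spinor n) :
    timeKernel (mollifier n ρ) u v
      = (-(n * ρ (‖u‖ ^ 2) + 2 * deriv ρ (‖u‖ ^ 2) * ‖u‖ ^ 2)) • v := by
  have h1 : HasFDerivAt (mollifier n ρ) _ u :=
    (h.hasFDerivAt u).smul (hasFDerivAt_const (ContinuousLinearMap.id ℝ (Spinor n)) u)
  rw [timeKernel, h1.fderiv]
  simp [mollifier, smul_smul]
  module

/-- The time derivative of the mollifier is in the range of the Dirac operator on test functions.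
-/
theorem dirac_test {σ : Fin n → HalfMatrix n} (hσ : IsDiracFamily σ) {ρ : ℝ → ℝ}
    (h : IsProfile n ρ) (e : Spinor n) (x : Space n) {t : ℝ} (y : Space n) :
    dirac σ (fun y => (t ^ n)⁻¹ • ρ (‖t⁻¹ • (x - y)‖ ^ 2) •
      Complex.I • clifford σ (t⁻¹ • (x - y)) e) y
      = t⁻¹ • (t ^ n)⁻¹ • timeKernel (mollifier n ρ) (t⁻¹ • (x - y)) e := by
  set u := t⁻¹ • (x - y) with hu
  have h0 : HasFDerivAt (fun y => t⁻¹ • (x - y))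
      (-(t⁻¹ • ContinuousLinearMap.id ℝ (Space n))) y := by
    have := ((hasFDerivAt_id (𝕜 := ℝ) y).const_sub x).const_smul t⁻¹
    rw [smul_neg] at this
    exact this
  have h1 : HasFDerivAt (fun y => ρ (‖t⁻¹ • (x - y)‖ ^ 2)) _ y :=
    HasFDerivAt.comp (g := fun y : Space n => ρ (‖y‖ ^ 2)) y (h.hasFDerivAt u) h0
  have h2 : HasFDerivAt (fun y => clifford σ (t⁻¹ • (x - y)) e) _ y :=
    (HasFDerivAt.comp (g := clifford σ) y ((clifford σ).hasFDerivAt (x := u)) h0).clm_apply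
      (hasFDerivAt_const e y)
  have h3 : HasFDerivAt (fun y => (t ^ n)⁻¹ • ρ (‖t⁻¹ • (x - y)‖ ^ 2) •
      Complex.I • clifford σ (t⁻¹ • (x - y)) e) _ y :=
    (h1.smul (h2.const_smul Complex.I)).const_smul (t ^ n)⁻¹
  have h4 : ∀ k, fderiv ℝ (fun y => (t ^ n)⁻¹ • ρ (‖t⁻¹ • (x - y)‖ ^ 2) •
      Complex.I • clifford σ (t⁻¹ • (x - y)) e) y (EuclideanSpace.single k 1)
      = (-Complex.I) • ((t ^ n)⁻¹ * t⁻¹ : ℝ) • (ρ (‖u‖ ^ 2) • act (alpha σ k) e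
        + (2 * deriv ρ (‖u‖ ^ 2)) • u k • clifford σ u e) := by
    intro k
    rw [HasFDerivAt.fderiv h3]
    simp only [Pi.smul_apply, ← hu]
    simp [clifford_single, EuclideanSpace.inner_single_right, -map_smul, -map_sub]
    simp only [RCLike.real_smul_eq_coe_smul (K := ℂ)]
    push_cast
    module
  rw [dirac]
  simp_rw [h4]
  have h5 : ∀ k, act (alpha σ k) ((-Complex.I) • ((t ^ n)⁻¹ * t⁻¹ : ℝ) •
        (ρ (‖u‖ ^ 2) • act (alpha σ k) e + (2 * deriv ρ (‖u‖ ^ 2)) • u k • clifford σ u e))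
      = (-Complex.I) • ((t ^ n)⁻¹ * t⁻¹ : ℝ) • (ρ (‖u‖ ^ 2) • e
        + (2 * deriv ρ (‖u‖ ^ 2)) • (u k • act (alpha σ k) (clifford σ u e))) := by
    intro k
    simp only [RCLike.real_smul_eq_coe_smul (K := ℂ), map_smul, map_add, act_alpha_sq hσ]
  simp_rw [h5, ← Finset.smul_sum, Finset.sum_add_distrib, ← Finset.smul_sum, ← clifford_apply,
    clifford_clifford hσ]
  rw [timeKernel_mollifier h, smul_smul, neg_mul_neg, Complex.I_mul_I, Finset.sum_const,
    Finset.card_univ, Fintype.card_fin, ← Nat.cast_smul_eq_nsmul ℝ]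
  module

/-- `𝒟 ψ = f` in the weak sense. -/
def IsWeakDiracSolution (σ : Fin n → HalfMatrix n) (ψ f : Space n → Spinor n) : Prop :=
  ∀ φ : Space n → Spinor n, ContDiff ℝ (⊤ : ℕ∞) φ → HasCompactSupport φ →
    ∫ x, inner ℂ (dirac σ φ x) (ψ x) = ∫ x, inner ℂ (φ x) (f x)

/-- For a weak solution of `𝒟 ψ = f`, the derivative in `t` of the mollification of `ψ` at scale
`t` is an average of `f`. -/
theorem inv_smul_avg_timeKernel {σ : Fin n → HalfMatrix n} (hσ : IsDiracFamily σ) {ρ : ℝ → ℝ}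
    (h : IsProfile n ρ) {ψ f : Space n → Spinor n} (hψ : LocallyIntegrable ψ)
    (hf : LocallyIntegrable f)
    (hweak : IsWeakDiracSolution σ ψ f) {t : ℝ} (ht : 0 < t)
    (x : Space n) :
    t⁻¹ • avg (timeKernel (mollifier n ρ)) ψ t x = avg (diracKernel σ ρ) f t x := by
  refine ext_inner_left ℂ fun e => ?_
  set φ : Space n → Spinor n := fun y => (t ^ n)⁻¹ • ρ (‖t⁻¹ • (x - y)‖ ^ 2) •
      Complex.I • clifford σ (t⁻¹ • (x - y)) e with hφ
  have hφs : ContDiff ℝ (⊤ : ℕ∞) φ := by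
    have h1 : ContDiff ℝ (⊤ : ℕ∞) (fun y : Space n => t⁻¹ • (x - y)) := by fun_prop
    have h2 : ContDiff ℝ (⊤ : ℕ∞) (fun y : Space n => clifford σ (t⁻¹ • (x - y)) e) :=
      ((clifford σ).contDiff.comp h1).clm_apply contDiff_const
    exact ContDiff.const_smul _ ((h.isKernel.smooth.comp h1).smul (h2.const_smul Complex.I))
  have hφc : HasCompactSupport φ := by
    refine HasCompactSupport.intro (isCompact_closedBall x t) fun y hy => ?_
    have := one_lt_norm_inv_smul_sub ht hy
    simp only [hφ]
    rw [h.support _ (by nlinarith)]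
    simp
  have key := hweak φ hφs hφc
  have hI1 := ((integrable_kernel_apply h.isKernel_mollifier.timeKernel hψ ht x).smul
    (t ^ n)⁻¹).smul t⁻¹
  have hI2 := (integrable_kernel_apply (h.isKernel_diracKernel σ) hf ht x).smul (t ^ n)⁻¹
  rw [avg_eq _ _ ht, avg_eq _ _ ht, ← integral_smul]
  refine ((integral_inner hI1 e).symm.trans ?_).trans (integral_inner hI2 e)
  refine Eq.trans ?_ (key.trans ?_)
  · refine integral_congr_ae (Eventually.of_forall fun y => ?_)
    simp only [hφ, dirac_test hσ h, Pi.smul_apply, timeKernel_mollifier h]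
    simp only [inner_real_smul_left]
    congr 1
    simp only [smul_smul]
    congr 1
    ring
  · refine integral_congr_ae (Eventually.of_forall fun y => ?_)
    simp only [hφ, Pi.smul_apply, diracKernel, inner_real_smul_left, smul_apply,
      inner_smul_left, inner_clifford, Complex.conj_I]
    rw [← inner_smul_right]
    congr 1
    set u := t⁻¹ • (x - y)
    rw [map_smul, map_smul]
    simp only [RCLike.real_smul_eq_coe_smul (K := ℂ)]
    module

end

/-! ### Hölder continuity of the nonlinear term -/

section

open Set Filter Topology

variable {n : ℕ}

/-- A number below `a` and `b` is below their weighted geometric means. -/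
theorem le_rpow_mul_rpow {x a b θ : ℝ} (hx : 0 ≤ x) (ha : x ≤ a) (hb : x ≤ b) (h0 : 0 ≤ θ)
    (h1 : θ ≤ 1) : x ≤ a ^ (1 - θ) * b ^ θ := by
  rcases hx.eq_or_lt with rfl | hx
  · positivity
  · calc x = x ^ (1 - θ) * x ^ θ := by rw [← Real.rpow_add hx]; simp
      _ ≤ a ^ (1 - θ) * b ^ θ := by
        have := hx.le.trans ha
        gcongr

theorem continuousAt_of_norm_sub_le_rpow {E F : Type*} [NormedAddCommGroup E]
    [NormedAddCommGroup F] {f : E → F} {x : E} {C α : ℝ} (hα : 0 < α)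
    (h : ∀ᶠ y in 𝓝 x, ‖f y - f x‖ ≤ C * ‖y - x‖ ^ α) : ContinuousAt f x := by
  rw [ContinuousAt, tendsto_iff_norm_sub_tendsto_zero]
  have h1 : Tendsto (fun y => C * ‖y - x‖ ^ α) (𝓝 x) (𝓝 0) := by
    have : Continuous fun y => C * ‖y - x‖ ^ α :=
      continuous_const.mul ((continuous_id.sub continuous_const).norm.rpow_const
        fun _ => Or.inr hα.le)
    simpa [hα.ne'] using this.tendsto x
  exact squeeze_zero' (Eventually.of_forall fun _ => norm_nonneg _) h h1

theorem rpow_sub_rpow_mul_le {a b s : ℝ} (hb : 0 ≤ b) (hab : b ≤ a) (ha : 0 < a) (hs : 0 ≤ s) :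
    (a ^ s - b ^ s) * b ≤ (s + 1) * a ^ s * (a - b) := by
  -- Bernoulli's inequality gives `a ^ (s + 1) - b ^ (s + 1) ≤ (s + 1) * a ^ s * (a - b)`.
  have h1 := one_add_mul_self_le_rpow_one_add (s := b / a - 1) (p := s + 1)
    (by have : 0 ≤ b / a := by positivity
        linarith) (by linarith)
  rw [add_sub_cancel, Real.div_rpow hb ha.le, le_div_iff₀ (by positivity),
    Real.rpow_add_one ha.ne', Real.rpow_add_one' hb (by linarith)] at h1
  have h2 : (1 + (s + 1) * (b / a - 1)) * (a ^ s * a)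
      = a ^ s * a - (s + 1) * a ^ s * (a - b) := by field_simp; ring
  have h3 : a ^ s * b ≤ a ^ s * a := by gcongr
  nlinarith

/-- The nonlinear term `h(z) z`. -/
noncomputable def nonlinearTerm (H : Spinor n → SpinorMatrix n) (z : Spinor n) : Spinor n :=
  act (homNonlinearity H z) z

/-- The direction `z / |z|`, written as in the definition of `h`. -/
noncomputable abbrev unitDir (z : Spinor n) : Spinor n := ((‖z‖⁻¹ : ℝ) : ℂ) • z

theorem norm_unitDir {z : Spinor n} (hz : z ≠ 0) : ‖unitDir z‖ = 1 := by
  rw [unitDir, norm_smul, Complex.norm_real, norm_inv, norm_norm,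
    inv_mul_cancel₀ (norm_ne_zero_iff.2 hz)]

theorem nonlinearTerm_eq (H : Spinor n → SpinorMatrix n) (z : Spinor n) :
    nonlinearTerm H z = (‖z‖ ^ (critExp n - 2)) • act (H (unitDir z)) z := by
  rw [nonlinearTerm, homNonlinearity, act, map_smul, smul_apply, Complex.coe_smul]

theorem act_sub (A B : SpinorMatrix n) : act (A - B) = act A - act B := map_sub _ _ _

theorem IsHolderOnSphere.exists_bound {β : ℝ} {H : Spinor n → SpinorMatrix n} (hβ : 0 ≤ β)
    (h : IsHolderOnSphere β H) : ∃ C : ℝ, 0 ≤ C ∧ ∀ z, ‖z‖ = 1 → ‖act (H z)‖ ≤ C := by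
  obtain ⟨K, hK⟩ := h
  by_cases hz : ∃ z₀ : Spinor n, ‖z₀‖ = 1
  · obtain ⟨z₀, hz₀⟩ := hz
    refine ⟨‖act (H z₀)‖ + |K| * 2 ^ β, by positivity, fun z hz => ?_⟩
    have h1 := hK z z₀ hz hz₀
    have h2 : ‖z - z₀‖ ≤ 2 := (norm_sub_le _ _).trans (by rw [hz, hz₀]; norm_num)
    have h3 : ‖act (H z - H z₀)‖ ≤ |K| * 2 ^ β := h1.trans (by gcongr; exact le_abs_self K)
    calc ‖act (H z)‖ = ‖act (H z₀) + act (H z - H z₀)‖ := by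
          rw [act_sub, add_sub_cancel]
      _ ≤ _ := (norm_add_le _ _).trans (by gcongr)
  · push Not at hz
    exact ⟨0, le_rfl, fun z h => absurd h (hz z)⟩

theorem norm_nonlinearTerm_le {H : Spinor n → SpinorMatrix n} {C : ℝ}
    (hC : ∀ z, ‖z‖ = 1 → ‖act (H z)‖ ≤ C) (z : Spinor n) :
    ‖nonlinearTerm H z‖ ≤ C * (‖z‖ ^ (critExp n - 2) * ‖z‖) := by
  rcases eq_or_ne z 0 with rfl | hz
  · simp [nonlinearTerm]
  · rw [nonlinearTerm_eq, norm_smul, Real.norm_of_nonneg (by positivity), mul_left_comm]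
    gcongr
    exact ContinuousLinearMap.le_of_opNorm_le _ (hC _ (norm_unitDir hz)) z

theorem norm_mul_unitDir_sub_le {z w : Spinor n} (hz : z ≠ 0) (hw : w ≠ 0) (h : ‖w‖ ≤ ‖z‖) :
    ‖w‖ * ‖unitDir z - unitDir w‖ ≤ 2 * ‖z - w‖ := by
  have hz' : 0 < ‖z‖ := norm_pos_iff.2 hz
  have hw' : 0 < ‖w‖ := norm_pos_iff.2 hw
  have e : ‖w‖ • (unitDir z - unitDir w) = (z - w) + (‖w‖ / ‖z‖ - 1) • z := by
    rw [unitDir, unitDir, Complex.coe_smul, Complex.coe_smul, smul_sub, smul_smul, smul_smul,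
      mul_inv_cancel₀ hw'.ne', one_smul, sub_smul, one_smul, div_eq_mul_inv]
    abel
  have h1 : ‖(‖w‖ / ‖z‖ - 1) • z‖ = ‖z‖ - ‖w‖ := by
    rw [norm_smul, Real.norm_eq_abs, abs_of_nonpos (by
      rw [sub_nonpos, div_le_one hz']; exact h)]
    field_simp; ring
  calc ‖w‖ * ‖unitDir z - unitDir w‖ = ‖‖w‖ • (unitDir z - unitDir w)‖ := by
        rw [norm_smul, norm_norm]
    _ ≤ ‖z - w‖ + (‖z‖ - ‖w‖) := by rw [e, ← h1]; exact norm_add_le _ _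
    _ ≤ 2 * ‖z - w‖ := by linarith [norm_sub_norm_le z w]

/-- On bounded sets `z ↦ h(z) z` has the Hölder exponent of `H`. The singularity of `z / |z|` at
the origin is compensated by the factor `|z|^(s + 1)`, where `s = 2^♯ - 2` is at least `β`. -/
theorem exists_holder_nonlinearTerm {H : Spinor n → SpinorMatrix n} {β : ℝ} (hβ : 0 < β)
    (hβ1 : β ≤ 1) (hβs : β ≤ critExp n - 2) (h : IsHolderOnSphere β H) {M : ℝ} (hM : 0 < M) :
    ∃ L : ℝ, 0 ≤ L ∧ ∀ z w, ‖z‖ ≤ M → ‖w‖ ≤ M →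
      ‖nonlinearTerm H z - nonlinearTerm H w‖ ≤ L * ‖z - w‖ ^ β := by
  obtain ⟨C, hC0, hC⟩ := h.exists_bound hβ.le
  obtain ⟨K, hK⟩ := h
  set s := critExp n - 2 with hs
  have hs0 : 0 < s := hβ.trans_le hβs
  set D := (2 * M) ^ (1 - β) with hD
  set L := M ^ s * C * D + C * ((s + 1) * M ^ s * D) + |K| * (M ^ (s + 1 - β) * 2 ^ β) with hL
  have hL0 : 0 ≤ L := by positivity
  have key : ∀ z w, ‖z‖ ≤ M → ‖w‖ ≤ ‖z‖ →
      ‖nonlinearTerm H z - nonlinearTerm H w‖ ≤ L * ‖z - w‖ ^ β := by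
    intro z w hz hwz
    have hlin : ‖z - w‖ ≤ D * ‖z - w‖ ^ β :=
      le_rpow_mul_rpow (norm_nonneg _) ((norm_sub_le _ _).trans (by linarith)) le_rfl hβ.le hβ1
    rcases eq_or_ne z 0 with rfl | hz0
    · have : w = 0 := by simpa using hwz
      subst this
      simp only [sub_self, norm_zero]; positivity
    have hzpos : 0 < ‖z‖ := norm_pos_iff.2 hz0
    rcases eq_or_ne w 0 with rfl | hw0
    · have e : nonlinearTerm H (0 : Spinor n) = 0 := by simp [nonlinearTerm]
      rw [e, sub_zero]
      refine (norm_nonlinearTerm_le hC z).trans ?_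
      rw [sub_zero] at hlin ⊢
      calc C * (‖z‖ ^ s * ‖z‖) ≤ C * (M ^ s * (D * ‖z‖ ^ β)) := by gcongr
        _ = M ^ s * C * D * ‖z‖ ^ β := by ring
        _ ≤ L * ‖z‖ ^ β := by
          gcongr
          rw [hL]
          have : 0 ≤ C * ((s + 1) * M ^ s * D) := by positivity
          have : 0 ≤ |K| * (M ^ (s + 1 - β) * 2 ^ β) := by positivity
          linarith
    have hwpos : 0 < ‖w‖ := norm_pos_iff.2 hw0
    have e : nonlinearTerm H z - nonlinearTerm H w = ‖z‖ ^ s • act (H (unitDir z)) (z - w)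
        + (‖z‖ ^ s - ‖w‖ ^ s) • act (H (unitDir z)) w
        + ‖w‖ ^ s • act (H (unitDir z) - H (unitDir w)) w := by
      rw [nonlinearTerm_eq, nonlinearTerm_eq, act_sub, map_sub, sub_apply]
      module
    have t1 : ‖‖z‖ ^ s • act (H (unitDir z)) (z - w)‖ ≤ M ^ s * (C * (D * ‖z - w‖ ^ β)) := by
      rw [norm_smul, Real.norm_of_nonneg (by positivity)]
      gcongr
      exact ContinuousLinearMap.le_of_opNorm_le_of_le _ (hC _ (norm_unitDir hz0)) hlin
    have t2 : ‖(‖z‖ ^ s - ‖w‖ ^ s) • act (H (unitDir z)) w‖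
        ≤ C * ((s + 1) * M ^ s * (D * ‖z - w‖ ^ β)) := by
      have h0 : 0 ≤ ‖z‖ ^ s - ‖w‖ ^ s := sub_nonneg.2 (by gcongr)
      rw [norm_smul, Real.norm_of_nonneg h0]
      calc (‖z‖ ^ s - ‖w‖ ^ s) * ‖act (H (unitDir z)) w‖
          ≤ (‖z‖ ^ s - ‖w‖ ^ s) * (C * ‖w‖) := by
            gcongr
            exact ContinuousLinearMap.le_of_opNorm_le _ (hC _ (norm_unitDir hz0)) w
        _ = C * ((‖z‖ ^ s - ‖w‖ ^ s) * ‖w‖) := by ring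
        _ ≤ C * ((s + 1) * ‖z‖ ^ s * (‖z‖ - ‖w‖)) := by
            gcongr C * ?_
            exact rpow_sub_rpow_mul_le hwpos.le hwz hzpos hs0.le
        _ ≤ C * ((s + 1) * M ^ s * (D * ‖z - w‖ ^ β)) := by
            have := norm_sub_norm_le z w
            have : 0 ≤ ‖z‖ - ‖w‖ := by linarith
            gcongr
            linarith
    have t3 : ‖‖w‖ ^ s • act (H (unitDir z) - H (unitDir w)) w‖
        ≤ |K| * (M ^ (s + 1 - β) * (2 ^ β * ‖z - w‖ ^ β)) := by
      rw [norm_smul, Real.norm_of_nonneg (by positivity)]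
      have h1 : ‖act (H (unitDir z) - H (unitDir w))‖ ≤ |K| * ‖unitDir z - unitDir w‖ ^ β :=
        (hK _ _ (norm_unitDir hz0) (norm_unitDir hw0)).trans (by gcongr; exact le_abs_self K)
      calc ‖w‖ ^ s * ‖act (H (unitDir z) - H (unitDir w)) w‖
          ≤ ‖w‖ ^ s * (|K| * ‖unitDir z - unitDir w‖ ^ β * ‖w‖) := by
            gcongr
            exact ContinuousLinearMap.le_of_opNorm_le _ h1 w
        _ = |K| * (‖w‖ ^ (s + 1 - β) * (‖w‖ * ‖unitDir z - unitDir w‖) ^ β) := by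
            rw [Real.mul_rpow hwpos.le (norm_nonneg _)]
            have : ‖w‖ ^ s * ‖w‖ = ‖w‖ ^ (s + 1 - β) * ‖w‖ ^ β := by
              rw [← Real.rpow_add hwpos, ← Real.rpow_add_one hwpos.ne', sub_add_cancel]
            linear_combination (|K| * ‖unitDir z - unitDir w‖ ^ β) * this
        _ ≤ |K| * (M ^ (s + 1 - β) * (2 * ‖z - w‖) ^ β) := by
            have : 0 ≤ s + 1 - β := by linarith
            gcongr _ * (?_ ^ _ * ?_ ^ _)
            · exact hwz.trans hz
            · exact norm_mul_unitDir_sub_le hz0 hw0 hwz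
        _ = _ := by rw [Real.mul_rpow two_pos.le (norm_nonneg _)]
    rw [e]
    refine (norm_add₃_le.trans (add_le_add_three t1 t2 t3)).trans (le_of_eq ?_)
    rw [hL]; ring
  refine ⟨L, hL0, fun z w hz hw => ?_⟩
  rcases le_total ‖w‖ ‖z‖ with hwz | hwz
  · exact key z w hz hwz
  · rw [norm_sub_rev, norm_sub_rev z]
    exact key w z hw hwz

theorem continuous_nonlinearTerm {H : Spinor n → SpinorMatrix n} {β : ℝ} (hβ : 0 < β)
    (hβ1 : β ≤ 1) (hβs : β ≤ critExp n - 2) (h : IsHolderOnSphere β H) :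
    Continuous (nonlinearTerm H) := by
  rw [continuous_iff_continuousAt]
  intro z
  obtain ⟨L, hL, hLz⟩ := exists_holder_nonlinearTerm hβ hβ1 hβs h (M := ‖z‖ + 1) (by positivity)
  refine continuousAt_of_norm_sub_le_rpow (C := L) hβ ?_
  filter_upwards [Metric.ball_mem_nhds z one_pos] with w hw
  refine hLz w z ?_ (by linarith)
  have h2 : ‖w - z‖ < 1 := by simpa [dist_eq_norm] using hw
  linarith [norm_sub_norm_le w z]

end

/-! ### Hölder estimates for the integral over scales -/

section

open Set Filter Topology

variable {n : ℕ} {V W : Type*} [NormedAddCommGroup V] [NormedSpace ℝ V] [NormedAddCommGroup W]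
  [NormedSpace ℝ W]

/-- The integral of the averages of `F` over the scales in `(0, 1]`. -/
noncomputable def avgIntegral (κ : Space n → V →L[ℝ] W) (F : Space n → V) (x : Space n) : W :=
  ∫ t in Ioc (0 : ℝ) 1, avg κ F t x

theorem IsKernel.exists_norm_avg_le {κ : Space n → V →L[ℝ] W} (hκ : IsKernel κ) :
    ∃ A : ℝ, 0 ≤ A ∧ ∀ (F : Space n → V) (c : ℝ), (∀ y, ‖F y‖ ≤ c) →
      ∀ t x, ‖avg κ F t x‖ ≤ A * c := by
  obtain ⟨C, hC, hb⟩ := hκ.exists_bound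
  refine ⟨C * (unitVol n).toReal, by positivity, fun F c hF t x => ?_⟩
  refine (norm_integral_le_of_kernel hκ.support hb fun y _ => hF _).trans (le_of_eq ?_)
  ring


theorem exists_norm_avgIntegral_le {κ : Space n → V →L[ℝ] W} (hκ : IsKernel κ)
    {F : Space n → V} {c : ℝ} (hc : ∀ y, ‖F y‖ ≤ c) :
    ∃ C : ℝ, ∀ x, ‖avgIntegral κ F x‖ ≤ C := by
  obtain ⟨A, _, hA⟩ := hκ.exists_norm_avg_le
  refine ⟨A * c, fun x => ?_⟩
  have := norm_setIntegral_le_of_norm_le_const (μ := volume) (s := Ioc (0 : ℝ) 1) (by simp)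
    fun t _ => hA F c hc t x
  simpa [avgIntegral] using this

variable [CompleteSpace W]

theorem aestronglyMeasurable_avg {κ : Space n → V →L[ℝ] W} (hκ : IsKernel κ)
    {F : Space n → V} (hF : LocallyIntegrable F) (x : Space n) :
    AEStronglyMeasurable (fun t => avg κ F t x) (volume.restrict (Ioc (0 : ℝ) 1)) :=
  ((continuousOn_avg hκ hF x).mono Ioc_subset_Ioi_self).aestronglyMeasurable measurableSet_Ioc

theorem integrableOn_avg {κ : Space n → V →L[ℝ] W} (hκ : IsKernel κ)
    {F : Space n → V} (hF : LocallyIntegrable F) {c : ℝ} (hc : ∀ y, ‖F y‖ ≤ c) (x : Space n) :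
    IntegrableOn (fun t => avg κ F t x) (Ioc (0 : ℝ) 1) := by
  obtain ⟨A, _, hA⟩ := hκ.exists_norm_avg_le
  exact IntegrableOn.of_bound (by simp) (aestronglyMeasurable_avg hκ hF x) (A * c)
    (Eventually.of_forall fun t => hA F c hc t x)

theorem integrableOn_Ioc_rpow {r : ℝ} (hr : -1 < r) (K : ℝ) :
    IntegrableOn (fun t : ℝ => K * t ^ r) (Ioc 0 1) := by
  refine Integrable.const_mul ?_ K
  rw [← IntegrableOn, integrableOn_Ioc_iff_integrableOn_Ioo]
  exact (intervalIntegral.integrableOn_Ioo_rpow_iff one_pos).2 hr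

theorem exists_lipschitz_avg {κ : Space n → V →L[ℝ] W} (hκ : IsKernel κ)
    {F : Space n → V} (hF : LocallyIntegrable F) {c : ℝ} (hc : ∀ y, ‖F y‖ ≤ c) :
    ∃ L : ℝ, 0 ≤ L ∧ ∀ t, 0 < t → ∀ x x', ‖avg κ F t x - avg κ F t x'‖ ≤ L * (t⁻¹ * ‖x - x'‖) := by
  obtain ⟨A, hA0, hA⟩ := hκ.gradKernel.exists_norm_avg_le
  have hc0 : 0 ≤ c := (norm_nonneg _).trans (hc 0)
  refine ⟨A * c, by positivity, fun t ht x x' => ?_⟩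
  have := Convex.norm_image_sub_le_of_norm_hasFDerivWithin_le (𝕜 := ℝ) (s := univ)
    (f := fun x => avg κ F t x) (C := t⁻¹ * (A * c))
    (fun x _ => (hasFDerivAt_avg hκ hF ht x).hasFDerivWithinAt) (fun x _ => by
      rw [norm_smul, norm_inv, Real.norm_of_nonneg ht.le]
      gcongr
      exact hA F c hc t x) convex_univ (mem_univ x') (mem_univ x)
  refine this.trans (le_of_eq ?_)
  ring

/-- For bounded `F` the increments of the average at scale `t` are at most a constant times `min
{1, |x - x'| / t}`, hence `t^(-γ) |x - x'|^γ`, which is integrable for `γ < 1`. -/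
theorem exists_holder_avgIntegral {κ : Space n → V →L[ℝ] W} (hκ : IsKernel κ)
    {F : Space n → V} (hF : LocallyIntegrable F) {c : ℝ} (hc : ∀ y, ‖F y‖ ≤ c) {γ : ℝ}
    (hγ0 : 0 ≤ γ) (hγ1 : γ < 1) :
    ∃ L : ℝ, 0 ≤ L ∧ ∀ x x', ‖avgIntegral κ F x - avgIntegral κ F x'‖ ≤ L * ‖x - x'‖ ^ γ := by
  obtain ⟨A, hA0, hA⟩ := hκ.exists_norm_avg_le
  obtain ⟨L, hL0, hL⟩ := exists_lipschitz_avg hκ hF hc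
  have hc0 : 0 ≤ c := (norm_nonneg _).trans (hc 0)
  set K := (2 * (A * c)) ^ (1 - γ) * L ^ γ with hK
  refine ⟨∫ t in Ioc (0 : ℝ) 1, K * t ^ (-γ), setIntegral_nonneg measurableSet_Ioc
    fun t ht => by have := ht.1; positivity, fun x x' => ?_⟩
  rw [avgIntegral, avgIntegral, ← integral_sub (integrableOn_avg hκ hF hc x)
    (integrableOn_avg hκ hF hc x'), ← integral_mul_const]
  refine norm_integral_le_of_norm_le ((integrableOn_Ioc_rpow (by linarith) K).mul_const _) ?_
  filter_upwards [ae_restrict_mem measurableSet_Ioc] with t ht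
  have h1 : ‖avg κ F t x - avg κ F t x'‖ ≤ 2 * (A * c) :=
    (norm_sub_le _ _).trans (by linarith [hA F c hc t x, hA F c hc t x'])
  have ht0 : 0 < t := ht.1
  refine (le_rpow_mul_rpow (norm_nonneg _) h1 (hL t ht0 x x') hγ0 hγ1.le).trans (le_of_eq ?_)
  rw [Real.mul_rpow hL0 (by positivity), Real.mul_rpow (by positivity) (norm_nonneg _),
    Real.inv_rpow ht0.le, ← Real.rpow_neg ht0.le, hK]
  ring

/-- For `F` Hölder continuous of order `γ`, the gradient of the average at scale `t` and its
Hölder seminorm of order `α < γ` are integrable in `t`. Since the kernel has mean zero, `F` enters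
through its differences `F(x - t y) - F(x)` only. -/
theorem exists_norm_avg_gradKernel_le {κ : Space n → V →L[ℝ] W} (hκ : IsKernel κ)
    {F : Space n → V} (hF : Continuous F) {L γ α : ℝ} (hα : 0 ≤ α) (hαγ : α < γ)
    (hL0 : 0 ≤ L) (hL : ∀ x x', ‖F x - F x'‖ ≤ L * ‖x - x'‖ ^ γ) :
    ∃ A : ℝ, 0 ≤ A ∧ (∀ t, 0 < t → ∀ x, ‖t⁻¹ • avg (gradKernel κ) F t x‖ ≤ A * t ^ (γ - 1)) ∧
      ∀ t, 0 < t → ∀ x x', ‖t⁻¹ • avg (gradKernel κ) F t x - t⁻¹ • avg (gradKernel κ) F t x'‖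
        ≤ A * t ^ (γ - α - 1) * ‖x - x'‖ ^ α := by
  obtain ⟨C, hC0, hC⟩ := hκ.gradKernel.exists_bound
  have hγ : 0 < γ := hα.trans_lt hαγ
  have hω : 0 ≤ (unitVol n).toReal := ENNReal.toReal_nonneg
  have hint : ∀ v : Space n → V, Continuous v → Integrable fun y => gradKernel κ y (v y) := by
    intro v hv
    refine Continuous.integrable_of_hasCompactSupport
      (hκ.gradKernel.smooth.continuous.clm_apply hv) ?_
    refine HasCompactSupport.intro (isCompact_closedBall (0 : Space n) 1) fun y hy => ?_
    rw [hκ.gradKernel.support y (by simpa using hy)]; rfl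
  have e : ∀ t x, avg (gradKernel κ) F t x = ∫ y, gradKernel κ y (F (x - t • y) - F x) := by
    intro t x
    simp_rw [map_sub]
    rw [integral_sub (hint _ (by fun_prop)) (hint _ (by fun_prop)), integral_gradKernel hκ,
      sub_zero]
    rfl
  have hosc : ∀ t, 0 < t → ∀ x y : Space n, ‖y‖ ≤ 1 → ‖F (x - t • y) - F x‖ ≤ L * t ^ γ := by
    intro t ht x y hy
    refine (hL _ _).trans ?_
    gcongr
    rw [sub_sub_cancel_left, norm_neg, norm_smul, Real.norm_of_nonneg ht.le]
    nlinarith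
  set A := 2 * (C * L * (unitVol n).toReal) with hA
  refine ⟨A, by positivity, fun t ht x => ?_, fun t ht x x' => ?_⟩
  · rw [norm_smul, norm_inv, Real.norm_of_nonneg ht.le, e]
    have := norm_integral_le_of_kernel hκ.gradKernel.support hC
      (q := fun y => F (x - t • y) - F x) (hosc t ht x)
    calc t⁻¹ * ‖∫ y, gradKernel κ y (F (x - t • y) - F x)‖
        ≤ t⁻¹ * (C * (L * t ^ γ) * (unitVol n).toReal) := by gcongr
      _ = (C * L * (unitVol n).toReal) * t ^ (γ - 1) := by rw [Real.rpow_sub_one ht.ne']; ring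
      _ ≤ A * t ^ (γ - 1) := by
        gcongr
        have : 0 ≤ C * L * (unitVol n).toReal := by positivity
        linarith
  · rw [← smul_sub, norm_smul, norm_inv, Real.norm_of_nonneg ht.le, e, e,
      ← integral_sub (hint _ (by fun_prop)) (hint _ (by fun_prop))]
    simp_rw [← map_sub]
    have hq : ∀ y : Space n, ‖y‖ ≤ 1 → ‖F (x - t • y) - F x - (F (x' - t • y) - F x')‖
        ≤ 2 * L * (t ^ (γ - α) * ‖x - x'‖ ^ α) := by
      intro y hy
      -- The second difference is small both if `t` is small and if `x` and `x'` are close;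
      -- interpolating between the two bounds leaves a positive power of `t`.
      have h1 : ‖F (x - t • y) - F x - (F (x' - t • y) - F x')‖ ≤ 2 * L * t ^ γ :=
        (norm_sub_le _ _).trans (by linarith [hosc t ht x y hy, hosc t ht x' y hy])
      have h2 : ‖F (x - t • y) - F x - (F (x' - t • y) - F x')‖ ≤ 2 * L * ‖x - x'‖ ^ γ := by
        have e2 : F (x - t • y) - F x - (F (x' - t • y) - F x')
            = (F (x - t • y) - F (x' - t • y)) - (F x - F x') := by abel
        rw [e2]
        refine (norm_sub_le _ _).trans ?_
        have h3 := hL (x - t • y) (x' - t • y)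
        rw [sub_sub_sub_cancel_right] at h3
        linarith [hL x x']
      refine (le_rpow_mul_rpow (norm_nonneg _) h1 h2 (div_nonneg hα hγ.le)
        ((div_le_one hγ).2 hαγ.le)).trans (le_of_eq ?_)
      have e3 : (2 * L) ^ (1 - α / γ) * (2 * L) ^ (α / γ) = 2 * L := by
        rw [← Real.rpow_add' (by positivity) (by simp)]; simp
      rw [Real.mul_rpow (x := 2 * L) (y := t ^ γ) (by positivity) (by positivity),
        Real.mul_rpow (x := 2 * L) (y := ‖x - x'‖ ^ γ) (by positivity) (by positivity),
        ← Real.rpow_mul ht.le, ← Real.rpow_mul (norm_nonneg _),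
        show γ * (1 - α / γ) = γ - α by field_simp, show γ * (α / γ) = α by field_simp]
      linear_combination (t ^ (γ - α) * ‖x - x'‖ ^ α) * e3
    calc t⁻¹ * ‖∫ y, gradKernel κ y (F (x - t • y) - F x - (F (x' - t • y) - F x'))‖
        ≤ t⁻¹ * (C * (2 * L * (t ^ (γ - α) * ‖x - x'‖ ^ α)) * (unitVol n).toReal) := by
          gcongr
          exact norm_integral_le_of_kernel hκ.gradKernel.support hC hq
      _ = A * t ^ (γ - α - 1) * ‖x - x'‖ ^ α := by
          rw [Real.rpow_sub_one ht.ne', hA]; ring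

theorem memC1Holder_of_hasFDerivAt {α : ℝ} (hα : 0 < α) {φ : Space n → Spinor n}
    {D : Space n → Space n →L[ℝ] Spinor n} (hD : ∀ x, HasFDerivAt φ (D x) x) {C₀ C₁ C₂ : ℝ}
    (h0 : ∀ x, ‖φ x‖ ≤ C₀) (h1 : ∀ x, ‖D x‖ ≤ C₁)
    (h2 : ∀ x y, ‖D x - D y‖ ≤ C₂ * ‖x - y‖ ^ α) : MemC1Holder α φ := by
  have e : fderiv ℝ φ = D := funext fun x => (hD x).fderiv
  refine ⟨?_, max C₀ (max C₁ C₂), fun x => (h0 x).trans (by simp), fun x => ?_, fun x y => ?_⟩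
  · rw [contDiff_one_iff_fderiv, e]
    exact ⟨fun x => (hD x).differentiableAt, continuous_iff_continuousAt.2 fun x =>
      continuousAt_of_norm_sub_le_rpow hα (Eventually.of_forall fun y => h2 y x)⟩
  · rw [e]; exact (h1 x).trans (by simp)
  · rw [e]
    refine (h2 x y).trans ?_
    gcongr
    simp

theorem MemC1Holder.sub {α : ℝ} {φ φ' : Space n → Spinor n} (h : MemC1Holder α φ)
    (h' : MemC1Holder α φ') : MemC1Holder α (fun x => φ x - φ' x) := by
  obtain ⟨hc, C, h0, h1, h2⟩ := h
  obtain ⟨hc', C', h0', h1', h2'⟩ := h'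
  have e : ∀ x, fderiv ℝ (fun x => φ x - φ' x) x = fderiv ℝ φ x - fderiv ℝ φ' x := fun x =>
    fderiv_fun_sub (hc.differentiable one_ne_zero x) (hc'.differentiable one_ne_zero x)
  refine ⟨hc.sub hc', C + C', fun x => ?_, fun x => ?_, fun x y => ?_⟩
  · exact (norm_sub_le _ _).trans (add_le_add (h0 x) (h0' x))
  · rw [e]; exact (norm_sub_le _ _).trans (add_le_add (h1 x) (h1' x))
  · rw [e, e, sub_sub_sub_comm, add_mul]
    exact (norm_sub_le _ _).trans (add_le_add (h2 x y) (h2' x y))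

theorem memC1Holder_avgIntegral {κ : Space n → V →L[ℝ] Spinor n} (hκ : IsKernel κ)
    {F : Space n → V} (hF : Continuous F) {c : ℝ} (hc : ∀ y, ‖F y‖ ≤ c) {L γ α : ℝ} (hα : 0 < α)
    (hαγ : α < γ) (hL0 : 0 ≤ L) (hL : ∀ x x', ‖F x - F x'‖ ≤ L * ‖x - x'‖ ^ γ) :
    MemC1Holder α (avgIntegral κ F) := by
  obtain ⟨A, hA0, hA1, hA2⟩ := exists_norm_avg_gradKernel_le hκ hF hα.le hαγ hL0 hL
  obtain ⟨C₀, hC₀⟩ := exists_norm_avgIntegral_le hκ hc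
  have hFl := hF.locallyIntegrable (μ := (volume : Measure (Space n)))
  have hmeas : ∀ x, AEStronglyMeasurable (fun t : ℝ => t⁻¹ • avg (gradKernel κ) F t x)
      (volume.restrict (Ioc (0 : ℝ) 1)) := fun x =>
    measurable_inv.aestronglyMeasurable.smul (aestronglyMeasurable_avg hκ.gradKernel hFl x)
  have hint : IntegrableOn (fun t : ℝ => A * t ^ (γ - 1)) (Ioc 0 1) :=
    integrableOn_Ioc_rpow (by linarith) A
  have hder : ∀ x, HasFDerivAt (avgIntegral κ F)
      (∫ t in Ioc (0 : ℝ) 1, t⁻¹ • avg (gradKernel κ) F t x) x := by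
    intro x
    refine hasFDerivAt_integral_of_dominated_of_fderiv_le (𝕜 := ℝ)
      (F' := fun x t => t⁻¹ • avg (gradKernel κ) F t x)
      (bound := fun t => A * t ^ (γ - 1)) univ_mem
      (Eventually.of_forall fun x => aestronglyMeasurable_avg hκ hFl x)
      (integrableOn_avg hκ hFl hc x) (hmeas x) ?_ hint ?_
    · filter_upwards [ae_restrict_mem measurableSet_Ioc] with t ht y _ using hA1 t ht.1 y
    · filter_upwards [ae_restrict_mem measurableSet_Ioc] with t ht y _ using
        hasFDerivAt_avg hκ hFl ht.1 y
  have hI : ∀ x, IntegrableOn (fun t : ℝ => t⁻¹ • avg (gradKernel κ) F t x) (Ioc 0 1) := fun x =>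
    Integrable.mono' hint (hmeas x) (by
      filter_upwards [ae_restrict_mem measurableSet_Ioc] with t ht using hA1 t ht.1 x)
  refine memC1Holder_of_hasFDerivAt hα hder hC₀ (C₁ := ∫ t in Ioc (0 : ℝ) 1, A * t ^ (γ - 1))
    (C₂ := ∫ t in Ioc (0 : ℝ) 1, A * t ^ (γ - α - 1)) (fun x => ?_) (fun x y => ?_)
  · refine norm_integral_le_of_norm_le hint ?_
    filter_upwards [ae_restrict_mem measurableSet_Ioc] with t ht using hA1 t ht.1 x
  · rw [← integral_sub (hI x) (hI y), ← integral_mul_const]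
    refine norm_integral_le_of_norm_le
      ((integrableOn_Ioc_rpow (by linarith) A).mul_const _) ?_
    filter_upwards [ae_restrict_mem measurableSet_Ioc] with t ht using hA2 t ht.1 x y

theorem memC1Holder_avg_one {κ : Space n → V →L[ℝ] Spinor n} (hκ : IsKernel κ)
    {F : Space n → V} (hF : Continuous F) {c : ℝ} (hc : ∀ y, ‖F y‖ ≤ c) {L α : ℝ} (hα : 0 < α)
    (hL : ∀ x x', ‖F x - F x'‖ ≤ L * ‖x - x'‖ ^ α) :
    MemC1Holder α (fun x => avg κ F 1 x) := by
  obtain ⟨A, hA0, hA⟩ := hκ.exists_norm_avg_le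
  obtain ⟨A', hA0', hA'⟩ := hκ.gradKernel.exists_norm_avg_le
  have hFl := hF.locallyIntegrable (μ := (volume : Measure (Space n)))
  have hder : ∀ x, HasFDerivAt (fun x => avg κ F 1 x) (avg (gradKernel κ) F 1 x) x := fun x => by
    simpa using hasFDerivAt_avg hκ hFl one_pos x
  obtain ⟨C, hC0, hC⟩ := hκ.gradKernel.exists_bound
  have hint : ∀ x, Integrable fun y => gradKernel κ y (F (x - (1 : ℝ) • y)) := by
    intro x
    refine Continuous.integrable_of_hasCompactSupport
      (hκ.gradKernel.smooth.continuous.clm_apply (by fun_prop)) ?_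
    refine HasCompactSupport.intro (isCompact_closedBall (0 : Space n) 1) fun y hy => ?_
    rw [hκ.gradKernel.support y (by simpa using hy)]; rfl
  refine memC1Holder_of_hasFDerivAt hα hder (hA F c hc 1) (hA' F c hc 1)
    (C₂ := C * L * (unitVol n).toReal) fun x x' => ?_
  rw [avg, avg, ← integral_sub (hint x) (hint x')]
  simp_rw [← map_sub]
  refine (norm_integral_le_of_kernel hκ.gradKernel.support hC (c := L * ‖x - x'‖ ^ α)
    fun y _ => ?_).trans (le_of_eq (by ring))
  have := hL (x - (1 : ℝ) • y) (x' - (1 : ℝ) • y)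
  rwa [sub_sub_sub_cancel_right] at this

end

/-! ### Regularity of weak solutions -/

section

open Set Filter Topology

variable {n : ℕ}

section Representation

variable {σ : Fin n → HalfMatrix n} {ρ : ℝ → ℝ} {ψ f : Space n → Spinor n}

theorem avg_one_sub_avg (hσ : IsDiracFamily σ) (h : IsProfile n ρ) (hψ : LocallyIntegrable ψ)
    (hf : LocallyIntegrable f) (hweak : IsWeakDiracSolution σ ψ f) {ε : ℝ} (hε : 0 < ε)
    (x : Space n) :
    avg (mollifier n ρ) ψ 1 x - avg (mollifier n ρ) ψ ε x
      = ∫ t in ε..1, avg (diracKernel σ ρ) f t x := by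
  have hpos : uIcc ε 1 ⊆ Ioi 0 := fun t ht => (lt_min hε one_pos).trans_le ht.1
  refine (intervalIntegral.integral_eq_sub_of_hasDerivAt
    (f := fun t => avg (mollifier n ρ) ψ t x) (fun t ht => ?_) ?_).symm
  · rw [← inv_smul_avg_timeKernel hσ h hψ hf hweak (hpos ht) x]
    exact hasDerivAt_avg h.isKernel_mollifier hψ (hpos ht) x
  · exact ((continuousOn_avg (h.isKernel_diracKernel σ) hf x).mono hpos).intervalIntegrable

/-- A weak solution of `𝒟 ψ = f` is dominated by its averages at scale one and by the potential of
`f`. No integrability of `f` beyond the local one is needed. -/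
theorem exists_enorm_le_ballAvg_add_potential (hσ : IsDiracFamily σ) (hψ : LocallyIntegrable ψ)
    (hf : LocallyIntegrable f) (hweak : IsWeakDiracSolution σ ψ f) :
    ∃ K : ℝ, ∀ᵐ x, ‖ψ x‖ₑ ≤ ENNReal.ofReal K * ballAvg (fun y => ‖ψ y‖ₑ) 1 x
      + ENNReal.ofReal K * potential (fun y => ‖f y‖ₑ) x := by
  obtain ⟨ρ, h⟩ := exists_isProfile n
  have hm := h.isKernel_mollifier
  have hd := h.isKernel_diracKernel σ
  obtain ⟨C₁, hC₁, hb₁⟩ := hm.exists_bound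
  obtain ⟨C₂, hC₂, hb₂⟩ := hd.exists_bound
  refine ⟨max C₁ C₂, ?_⟩
  filter_upwards [tendsto_avg_of_integral_eq_one h.isKernel h.integral hψ] with x hx
  refine le_of_tendsto (((continuous_enorm.tendsto _).comp hx)) ?_
  filter_upwards [Ioo_mem_nhdsGT (one_pos : (0 : ℝ) < 1)] with ε hε
  have e : avg (mollifier n ρ) ψ ε x = avg (mollifier n ρ) ψ 1 x
      - ∫ t in ε..1, avg (diracKernel σ ρ) f t x := by
    rw [← avg_one_sub_avg hσ h hψ hf hweak hε.1, sub_sub_cancel]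
  change ‖avg (mollifier n ρ) ψ ε x‖ₑ ≤ _
  rw [e]
  refine enorm_sub_le.trans (add_le_add ?_ ?_)
  · refine (enorm_avg_le hm.support hb₁ ψ 1 x).trans ?_
    gcongr
    exact le_max_left _ _
  · rw [intervalIntegral.integral_of_le hε.2.le]
    refine (enorm_integral_le_lintegral_enorm _).trans ?_
    refine (lintegral_mono_set (Ioc_subset_Ioc_left hε.1.le)).trans ?_
    rw [← restrict_Ioo_eq_restrict_Ioc, potential,
      ← lintegral_const_mul' _ _ ENNReal.ofReal_ne_top]
    refine lintegral_mono fun t => (enorm_avg_le hd.support hb₂ f t x).trans ?_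
    gcongr
    exact le_max_right _ _

/-- The representation formula for a weak solution of `𝒟 ψ = f` with bounded `f`. -/
theorem ae_eq_avg_sub_avgIntegral (hσ : IsDiracFamily σ) (h : IsProfile n ρ)
    (hψ : LocallyIntegrable ψ) (hf : LocallyIntegrable f) (hweak : IsWeakDiracSolution σ ψ f)
    {c : ℝ} (hc : ∀ y, ‖f y‖ ≤ c) :
    ∀ᵐ x, ψ x = avg (mollifier n ρ) ψ 1 x - avgIntegral (diracKernel σ ρ) f x := by
  have hd := h.isKernel_diracKernel σ
  obtain ⟨A, _, hA⟩ := hd.exists_norm_avg_le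
  filter_upwards [tendsto_avg_of_integral_eq_one h.isKernel h.integral hψ] with x hx
  refine tendsto_nhds_unique hx ?_
  have hint := integrableOn_avg hd hf hc x
  have h1 : Tendsto (fun ε : ℝ => ∫ t in Ioc 0 ε, avg (diracKernel σ ρ) f t x) (𝓝[>] 0) (𝓝 0) := by
    have h2 : Tendsto (fun ε : ℝ => A * c * ε) (𝓝[>] 0) (𝓝 0) := by
      have : Continuous fun ε : ℝ => A * c * ε := by fun_prop
      simpa using (this.tendsto 0).mono_left nhdsWithin_le_nhds
    refine squeeze_zero_norm' ?_ h2
    filter_upwards [self_mem_nhdsWithin] with ε (hε : 0 < ε)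
    have := norm_setIntegral_le_of_norm_le_const (μ := volume) (s := Ioc (0 : ℝ) ε) (by simp)
      fun t _ => hA f c hc t x
    simpa [hε.le] using this
  have h3 : Tendsto (fun ε : ℝ => avg (mollifier n ρ) ψ 1 x - (avgIntegral (diracKernel σ ρ) f x
      - ∫ t in Ioc 0 ε, avg (diracKernel σ ρ) f t x)) (𝓝[>] 0)
      (𝓝 (avg (mollifier n ρ) ψ 1 x - (avgIntegral (diracKernel σ ρ) f x - 0))) :=
    tendsto_const_nhds.sub (tendsto_const_nhds.sub h1)
  rw [sub_zero] at h3
  refine h3.congr' ?_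
  filter_upwards [Ioo_mem_nhdsGT (one_pos : (0 : ℝ) < 1)] with ε hε
  have e := avg_one_sub_avg hσ h hψ hf hweak hε.1 x
  rw [intervalIntegral.integral_of_le hε.2.le] at e
  have e2 : avgIntegral (diracKernel σ ρ) f x = (∫ t in Ioc 0 ε, avg (diracKernel σ ρ) f t x)
      + ∫ t in Ioc ε 1, avg (diracKernel σ ρ) f t x := by
    rw [avgIntegral, ← Ioc_union_Ioc_eq_Ioc hε.1.le hε.2.le]
    exact setIntegral_union (Ioc_disjoint_Ioc_of_le le_rfl) measurableSet_Ioc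
      (hint.mono_set (Ioc_subset_Ioc_right hε.2.le)) (hint.mono_set (Ioc_subset_Ioc_left hε.1.le))
  rw [e2, ← e, add_sub_cancel_left, sub_sub_cancel]
  rfl

end Representation

theorem holderExp_pos (hn : 2 ≤ n) : 0 < holderExp n := by
  have : (2 : ℝ) ≤ n := by exact_mod_cast hn
  have : 0 < (n : ℝ) - 1 := by linarith
  exact lt_min (by positivity) one_pos

theorem holderExp_le_one (n : ℕ) : holderExp n ≤ 1 := min_le_right _ _

theorem holderExp_le (hn : 2 ≤ n) : holderExp n ≤ critExp n - 2 := by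
  rw [critExp_sub_two hn]; exact min_le_left _ _

theorem potential_const_mul {g : Space n → ENNReal} (hg : Measurable g) (c : ENNReal)
    (x : Space n) : potential (fun y => c * g y) x = c * potential g x := by
  have h1 : ∀ t, ballAvg (fun y => c * g y) t x = c * ballAvg g t x := fun t =>
    lintegral_const_mul _ (by fun_prop)
  simp_rw [potential, h1]
  exact lintegral_const_mul _
    ((measurable_ballAvg_uncurry hg).comp (measurable_const.prodMk measurable_id))

section NonlinearEquation

variable {σ : Fin n → HalfMatrix n} {H : Spinor n → SpinorMatrix n} {ψ : Space n → Spinor n}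

/-- The growth `|h(z) z| ≤ C |z|^(2^♯ - 1)` makes the nonlinear term locally integrable. -/
theorem locallyIntegrable_nonlinearTerm (hn : 2 ≤ n) (hH : IsHolderOnSphere (holderExp n) H)
    (hψ : MemLp ψ (ENNReal.ofReal (critExp n)) volume) :
    LocallyIntegrable fun x => nonlinearTerm H (ψ x) := by
  have hβ := holderExp_pos hn
  have hs : 0 < critExp n - 2 := hβ.trans_le (holderExp_le hn)
  obtain ⟨C, hC0, hC⟩ := hH.exists_bound hβ.le
  have hI : Integrable fun x => ‖ψ x‖ ^ critExp n := by
    have := hψ.integrable_norm_rpow (by simp; linarith) ENNReal.ofReal_ne_top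
    rwa [ENNReal.toReal_ofReal (by linarith)] at this
  have hg : LocallyIntegrable fun x => C * (1 + ‖ψ x‖ ^ critExp n) := by
    have : LocallyIntegrable fun x => C * 1 + C * ‖ψ x‖ ^ critExp n :=
      (locallyIntegrable_const _).add (hI.const_mul C).locallyIntegrable
    simpa only [mul_add] using this
  refine hg.mono ((continuous_nonlinearTerm hβ (holderExp_le_one n) (holderExp_le hn)
    hH).comp_aestronglyMeasurable hψ.1) (Eventually.of_forall fun x => ?_)
  refine (norm_nonlinearTerm_le hC (ψ x)).trans ?_
  rw [Real.norm_of_nonneg (by positivity)]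
  gcongr
  rcases le_total ‖ψ x‖ 1 with h1 | h1
  · have h2 : ‖ψ x‖ ^ (critExp n - 2) ≤ 1 := Real.rpow_le_one (norm_nonneg _) h1 hs.le
    have h3 : 0 ≤ ‖ψ x‖ ^ critExp n := by positivity
    nlinarith [norm_nonneg (ψ x)]
  · have h0 : 0 < ‖ψ x‖ := by linarith
    rw [← Real.rpow_add_one h0.ne']
    have := Real.rpow_le_rpow_of_exponent_le h1 (by linarith : critExp n - 2 + 1 ≤ critExp n)
    linarith

/-- A weak solution of the critical equation is bounded. -/
theorem exists_ae_norm_le (hn : 2 ≤ n) (hσ : IsDiracFamily σ)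
    (hH : IsHolderOnSphere (holderExp n) H) (hψm : Measurable ψ)
    (hψ : MemLp ψ (ENNReal.ofReal (critExp n)) volume)
    (hweak : IsWeakDiracSolution σ ψ (fun x => nonlinearTerm H (ψ x))) :
    ∃ B : ℝ, ∀ᵐ x, ‖ψ x‖ ≤ B := by
  have hβ := holderExp_pos hn
  have hs : 0 < critExp n - 2 := hβ.trans_le (holderExp_le hn)
  obtain ⟨C, hC0, hC⟩ := hH.exists_bound hβ.le
  have hψl : LocallyIntegrable ψ := hψ.locallyIntegrable (by
    rw [ENNReal.one_le_ofReal]; linarith)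
  obtain ⟨K, hK⟩ := exists_enorm_le_ballAvg_add_potential hσ hψl
    (locallyIntegrable_nonlinearTerm hn hH hψ) hweak
  refine exists_ae_le_of_le_potential hn (u := fun x => ‖ψ x‖) hψm.norm (fun x => norm_nonneg _)
    ?_ (K := max (ENNReal.ofReal K) (ENNReal.ofReal K * ENNReal.ofReal C)) (by finiteness) ?_
  · have := lintegral_rpow_enorm_lt_top_of_eLpNorm_lt_top (by simp; linarith)
      ENNReal.ofReal_ne_top hψ.2
    rw [ENNReal.toReal_ofReal (by linarith)] at this
    simpa only [ofReal_norm] using this.ne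
  · filter_upwards [hK] with x hx
    simp only [ofReal_norm]
    refine hx.trans (add_le_add ?_ ?_)
    · gcongr
      exact le_max_left _ _
    · have h1 : potential (fun y => ‖nonlinearTerm H (ψ y)‖ₑ) x ≤ ENNReal.ofReal C
          * potential (fun y => ENNReal.ofReal (‖ψ y‖ ^ (critExp n - 2)) * ‖ψ y‖ₑ) x := by
        rw [← potential_const_mul (by fun_prop)]
        refine potential_mono_ae (Eventually.of_forall fun y => ?_) x
        rw [← ofReal_norm, ← ofReal_norm, ← ENNReal.ofReal_mul (by positivity),
          ← ENNReal.ofReal_mul hC0]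
        exact ENNReal.ofReal_le_ofReal (norm_nonlinearTerm_le hC (ψ y))
      calc _ ≤ ENNReal.ofReal K * (ENNReal.ofReal C * potential
            (fun y => ENNReal.ofReal (‖ψ y‖ ^ (critExp n - 2)) * ‖ψ y‖ₑ) x) := by gcongr
        _ ≤ _ := by
          rw [← mul_assoc]
          gcongr
          exact le_max_right _ _

/-- The regularity of bounded weak solutions: the representation formula gives Hölder continuity
of every order below one, then also Hölder continuity of the derivative. -/
theorem exists_memC1Holder_of_bounded (hn : 2 ≤ n) (hσ : IsDiracFamily σ)
    (hH : IsHolderOnSphere (holderExp n) H) (hψm : Measurable ψ) {B : ℝ} (hB : ∀ x, ‖ψ x‖ ≤ B)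
    (hweak : IsWeakDiracSolution σ ψ (fun x => nonlinearTerm H (ψ x))) :
    ∃ φ : Space n → Spinor n, ψ =ᵐ[volume] φ ∧
      ∀ α : ℝ, 0 < α → α < holderExp n → MemC1Holder α φ := by
  obtain ⟨ρ, h⟩ := exists_isProfile n
  have hm := h.isKernel_mollifier
  have hd := h.isKernel_diracKernel σ
  set β := holderExp n with hβdef
  have hβ : 0 < β := holderExp_pos hn
  have hβ1 : β ≤ 1 := holderExp_le_one n
  have hcont := continuous_nonlinearTerm hβ hβ1 (holderExp_le hn) hH
  have hlocb : ∀ (g : Space n → Spinor n) (c : ℝ), Measurable g → (∀ x, ‖g x‖ ≤ c) →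
      LocallyIntegrable g := fun g c hg hc =>
    (locallyIntegrable_const c).mono hg.aestronglyMeasurable
      (Eventually.of_forall fun x => (hc x).trans (le_abs_self c))
  have hbound : ∀ M : ℝ, ∃ c : ℝ, ∀ z : Spinor n, ‖z‖ ≤ M → ‖nonlinearTerm H z‖ ≤ c := by
    intro M
    obtain ⟨c, hc⟩ := (isCompact_closedBall (0 : Spinor n) M).exists_bound_of_continuousOn
      hcont.continuousOn
    exact ⟨c, fun z hz => hc z (by simpa using hz)⟩
  obtain ⟨c, hc⟩ := hbound B
  have hψl := hlocb ψ B hψm hB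
  have hfl := hlocb _ c (hcont.measurable.comp hψm) fun x => hc _ (hB x)
  set φ : Space n → Spinor n := fun x => avg (mollifier n ρ) ψ 1 x
    - avgIntegral (diracKernel σ ρ) (fun x => nonlinearTerm H (ψ x)) x with hφ
  have hae : ψ =ᵐ[volume] φ := ae_eq_avg_sub_avgIntegral hσ h hψl hfl hweak fun x => hc _ (hB x)
  refine ⟨φ, hae, fun α hα0 hαβ => ?_⟩
  obtain ⟨A, hA0, hA⟩ := hm.exists_norm_avg_le
  obtain ⟨C, hC⟩ := exists_norm_avgIntegral_le hd
    (F := fun x => nonlinearTerm H (ψ x)) fun x => hc _ (hB x)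
  set M := max 1 (A * B + C) with hM
  have hφM : ∀ x, ‖φ x‖ ≤ M := fun x =>
    ((norm_sub_le _ _).trans (add_le_add (hA ψ B hB 1 x) (hC x))).trans (le_max_right _ _)
  obtain ⟨L₁, hL₁0, hL₁⟩ := exists_lipschitz_avg hm hψl hB
  have hφH : ∀ γ : ℝ, 0 < γ → γ < 1 → ∃ L : ℝ, 0 ≤ L ∧ ∀ x x', ‖φ x - φ x'‖ ≤ L * ‖x - x'‖ ^ γ := by
    intro γ hγ0 hγ1
    obtain ⟨L₂, hL₂0, hL₂⟩ := exists_holder_avgIntegral hd hfl (fun x => hc _ (hB x)) hγ0.le hγ1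
    refine ⟨(2 * (A * B)) ^ (1 - γ) * L₁ ^ γ + L₂, ?_, fun x x' => ?_⟩
    · have : 0 ≤ B := (norm_nonneg _).trans (hB 0)
      positivity
    · have h1 : ‖avg (mollifier n ρ) ψ 1 x - avg (mollifier n ρ) ψ 1 x'‖ ≤ 2 * (A * B) :=
        (norm_sub_le _ _).trans (by linarith [hA ψ B hB 1 x, hA ψ B hB 1 x'])
      have h2 := hL₁ 1 one_pos x x'
      rw [inv_one, one_mul] at h2
      have h3 := le_rpow_mul_rpow (norm_nonneg _) h1 h2 hγ0.le hγ1.le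
      rw [Real.mul_rpow hL₁0 (norm_nonneg _), ← mul_assoc] at h3
      simp only [hφ]
      rw [sub_sub_sub_comm, add_mul]
      exact (norm_sub_le _ _).trans (add_le_add h3 (hL₂ x x'))
  have hφc : Continuous φ := by
    obtain ⟨L, hL0, hL⟩ := hφH (1 / 2) (by norm_num) (by norm_num)
    exact continuous_iff_continuousAt.2 fun x =>
      continuousAt_of_norm_sub_le_rpow (by norm_num) (Eventually.of_forall fun y => hL y x)
  have hφeq : φ = fun x => avg (mollifier n ρ) φ 1 x
      - avgIntegral (diracKernel σ ρ) (fun x => nonlinearTerm H (φ x)) x := by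
    ext1 x
    have e1 := avg_congr_ae (mollifier n ρ) hae one_pos x
    have e2 : avgIntegral (diracKernel σ ρ) (fun x => nonlinearTerm H (ψ x)) x
        = avgIntegral (diracKernel σ ρ) (fun x => nonlinearTerm H (φ x)) x :=
      setIntegral_congr_fun measurableSet_Ioc fun t ht => avg_congr_ae _ (by
        filter_upwards [hae] with y hy
        rw [hy]) ht.1 x
    rw [← e1, ← e2]
  obtain ⟨c', hc'⟩ := hbound M
  rw [hφeq]
  refine MemC1Holder.sub ?_ ?_
  · obtain ⟨L, hL0, hL⟩ := hφH α hα0 (hαβ.trans_le hβ1)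
    exact memC1Holder_avg_one hm hφc hφM hα0 hL
  · -- the Hölder exponent of the nonlinear term lies strictly between `α` and `β`
    set γ := (α + β) / 2 with hγ
    have hγβ : γ < β := by linarith
    have hαγ : α < γ := by linarith
    obtain ⟨L, hL0, hL⟩ := hφH (γ / β) (div_pos (hα0.trans hαγ) hβ) ((div_lt_one hβ).2 hγβ)
    obtain ⟨L', hL'0, hL'⟩ := exists_holder_nonlinearTerm hβ hβ1 (holderExp_le hn) hH
      (M := M) (one_pos.trans_le (le_max_left _ _))
    refine memC1Holder_avgIntegral hd (hcont.comp hφc) (fun x => hc' _ (hφM x)) hα0 hαγ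
      (L := L' * L ^ β) (by positivity) fun x x' => ?_
    refine (hL' _ _ (hφM x) (hφM x')).trans ?_
    have e : (L * ‖x - x'‖ ^ (γ / β)) ^ β = L ^ β * ‖x - x'‖ ^ γ := by
      rw [Real.mul_rpow hL0 (by positivity), ← Real.rpow_mul (norm_nonneg _),
        div_mul_cancel₀ _ hβ.ne']
    rw [mul_assoc, ← e]
    gcongr
    exact hL x x'

theorem IsWeakDiracSolution.congr_ae {ψ' : Space n → Spinor n} (h : ψ =ᵐ[volume] ψ')
    (hweak : IsWeakDiracSolution σ ψ (fun x => nonlinearTerm H (ψ x))) :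
    IsWeakDiracSolution σ ψ' (fun x => nonlinearTerm H (ψ' x)) := by
  intro φ hφ hφc
  have h1 : ∫ x, inner ℂ (dirac σ φ x) (ψ' x) = ∫ x, inner ℂ (dirac σ φ x) (ψ x) :=
    integral_congr_ae (by filter_upwards [h] with x hx; rw [hx])
  have h2 : ∫ x, inner ℂ (φ x) (nonlinearTerm H (ψ' x))
      = ∫ x, inner ℂ (φ x) (nonlinearTerm H (ψ x)) :=
    integral_congr_ae (by filter_upwards [h] with x hx; rw [hx])
  rw [h1, h2]
  exact hweak φ hφ hφc

end NonlinearEquation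

end

end CriticalDirac

theorem proposition5p1 (n : ℕ) (hn : 2 ≤ n)
    (σ : Fin n → CriticalDirac.HalfMatrix n) (hσ : CriticalDirac.IsDiracFamily σ)
    (H : CriticalDirac.Spinor n → CriticalDirac.SpinorMatrix n)
    (hHolder : CriticalDirac.IsHolderOnSphere (CriticalDirac.holderExp n) H)
    (hInv : CriticalDirac.IsConjInvariant σ H)
    (ψ : CriticalDirac.Space n → CriticalDirac.Spinor n)
    (hψ : MemLp ψ (ENNReal.ofReal (CriticalDirac.critExp n)) volume)
    (hsol : CriticalDirac.IsWeakSolution σ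
      (fun _ z => CriticalDirac.homNonlinearity H z) ψ) :
    ∃ φ : CriticalDirac.Space n → CriticalDirac.Spinor n, ψ =ᵐ[volume] φ ∧
      ∀ α : ℝ, 0 < α → α < CriticalDirac.holderExp n → CriticalDirac.MemC1Holder α φ := by
  have hweak : CriticalDirac.IsWeakDiracSolution σ ψ
      (fun x => CriticalDirac.nonlinearTerm H (ψ x)) := hsol
  obtain ⟨ψ₁, hψ₁, hae₁⟩ := hψ.1
  have hweak₁ := hweak.congr_ae hae₁
  obtain ⟨B, hB⟩ := CriticalDirac.exists_ae_norm_le hn hσ hHolder hψ₁.measurable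
    (hψ.ae_eq hae₁) hweak₁
  have hS : MeasurableSet {x | ‖ψ₁ x‖ ≤ B} := measurableSet_le hψ₁.measurable.norm measurable_const
  have hae₂ : ψ₁ =ᵐ[volume] {x | ‖ψ₁ x‖ ≤ B}.indicator ψ₁ := by
    filter_upwards [hB] with x hx
    exact (Set.indicator_of_mem (s := {x | ‖ψ₁ x‖ ≤ B}) hx ψ₁).symm
  obtain ⟨φ, hφ, hφα⟩ := CriticalDirac.exists_memC1Holder_of_bounded hn hσ hHolder
    (hψ₁.measurable.indicator hS) (B := max B 0) (fun x => by
      by_cases hx : x ∈ {x | ‖ψ₁ x‖ ≤ B}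
      · rw [Set.indicator_of_mem hx]; exact (show ‖ψ₁ x‖ ≤ B from hx).trans (le_max_left _ _)
      · rw [Set.indicator_of_notMem hx]; simp) (hweak₁.congr_ae hae₂)
  exact ⟨φ, hae₁.trans (hae₂.trans hφ), hφα⟩
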